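/- Let $d,m\ge 1$ and $\mathbb E=\mathbb R^d\times\{1,\dots,m\}$; a point $(x,i)$ is the point $x$ with colour $i$. Let $C_R=(-R/2,R/2)^d$ and let $\ell$ be Lebesgue measure. A set $\Lambda\subset\mathbb E$ is $r$-uniformly discrete if for every $a\in\mathbb R^d$ at most one $(x,i)\in\Lambda$ has $x\in a+C_r$. For a measure $\lambda$ on $\mathbb E$ let $\lambda^i$ be its part of colour $i$, viewed as a measure on $\mathbb R^d$, and let $T_t\lambda$ be its translate by $t\in\mathbb R^d$. Let $\mu$ be the law of a uniformly discrete, multicoloured, stationary, ergodic point process on $\mathbb R^d$, that is, a probability measure on the measures on $\mathbb E$ (with the $\sigma$-algebra generated by the maps $\lambda\mapsto\lambda(A)$, $A\subset\mathbb E$ Borel) such that: for some $r>0$, $\mu$-almost every $\lambda$ has the form $\sum_{p\in\Lambda}\delta_p$ with $\Lambda$ an $r$-uniformly discrete set; $\mu$ is invariant under all $T_t$; every measurable set that is invariant under all $T_t$ has $\mu$-measure $0$ or $1$; and for each $i$ the intensity $I^{(i)}=\int\lambda^i(C_1)\,d\mu(\lambda)$ is positive. Let $w=(w_1,\dots,w_m)\in\mathbb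 R^m$ be a system of weights, and put $\lambda^w=\sum_i w_i\lambda^i$ and $N^w_f(\lambda)=\lambda^w(f)=\sum_i w_i\int f\,d\lambda^i$. Let $\dot\mu^w$ be the weighted Palm measure, $$\dot\mu^w(D)=\int\sum_{x\in C_1}\lambda^w(\{x\})\,\mathbf 1_D(T_{-x}\lambda)\,d\mu(\lambda),$$ and let $\dot\mu^w_1$, defined by $\dot\mu^w_1(f)=\int N^w_f\,d\dot\mu^w$, be its weighted first moment. With $\hat f(y)=\int e^{-2\pi i\,y\cdot x}f(x)\,dx$ and $\mathbb S$ the space of rapidly decreasing (Schwartz) functions on $\mathbb R^d$, the following hold. There is exactly one positive Radon measure $\nu=\widehat{\dot\mu^w_1}$ on $\mathbb R^d$ for which every $f\in\mathbb S$ is integrable and $\int f\,d\nu=\dot\mu^w_1(\hat f)$ for all $f\in\mathbb S$. There is exactly one linear isometry $\theta^w:L^2(\mathbb R^d,\nu)\to L^2(\mu)$ with $\theta^w(\hat f)=N^w_f$ for all $f\in\mathbb S$. Let $U$ be the representation of $\mathbb R^d$ on $L^2(\mathbb R^d,\nu)$ given by $U_tf(x)=e^{-2\pi i\,t\cdot x}f(x)$;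 $k\in\mathbb R^d$ is an eigenvalue of $U$ if there is a nonzero $f\in L^2(\mathbb R^d,\nu)$ with $U_tf=e^{2\pi i\,k\cdot t}f$ for all $t\in\mathbb R^d$. **Theorem 9.1 (square-mean Bombieri–Taylor).** For every $k\in\mathbb R^d$ the averages $$A_R(\lambda)=\frac1{\ell(C_R)}\sum_{x\in C_R}\lambda^w(\{x\})\,e^{2\pi i\,k\cdot x}\qquad(R>0)$$ belong to $L^2(\mu)$, and the following are equivalent: (i) $A_R\nrightarrow 0$ in $L^2(\mu)$ as $R\to\infty$; (ii) $\widehat{\dot\mu^w_1}(\{k\})\ne 0$; (iii) $k$ is an eigenvalue of $U$. If $k$ is an eigenvalue of $U$, then $A_R\to\theta^w(\mathbf 1_{\{k\}})$ in $L^2(\mu)$ as $R\to\infty$. -/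

import Mathlib

open MeasureTheory Filter Topology
open scoped FourierTransform SchwartzMap ENNReal

namespace ColouredPointProcess

/-- Euclidean space `ℝ^d`. -/
abbrev Space (d : ℕ) : Type := EuclideanSpace ℝ (Fin d)

/-- `𝔼 = ℝ^d × {1, …, m}`: a pair `(x, i)` is the point `x` with colour `i`. -/
abbrev ColouredSpace (d m : ℕ) : Type := Space d × Fin m

/-- The open cube `C_R` of edge length `R` centred at `0`. -/
def cube (d : ℕ) (R : ℝ) : Set (Space d) := {x | ∀ j, |x j| < R / 2}

/-- `Λ ⊆ 𝔼` is `r`-uniformly discrete: every translate `a + C_r` contains the position of at most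
one point of `Λ`, all colours taken together. -/
def UniformlyDiscrete {d m : ℕ} (r : ℝ) (Λ : Set (ColouredSpace d m)) : Prop :=
  ∀ a : Space d, {p ∈ Λ | p.1 - a ∈ cube d r}.encard ≤ 1

/-- The point measures `∑_{p ∈ Λ} δ_p` on `𝔼` whose support `Λ` is `r`-uniformly discrete. -/
def pointMeasures (d m : ℕ) (r : ℝ) : Set (Measure (ColouredSpace d m)) :=
  {η | ∃ Λ : Set (ColouredSpace d m), UniformlyDiscrete r Λ ∧
    η = Measure.sum fun p : Λ => Measure.dirac (p : ColouredSpace d m)}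

/-- The translate `T_t η` of a measure on `𝔼`: `(T_t η)(A) = η (-t + A)`. -/
noncomputable def translate {d m : ℕ} (t : Space d) (η : Measure (ColouredSpace d m)) :
    Measure (ColouredSpace d m) :=
  η.map fun p => (t + p.1, p.2)

/-- The part `η^i` of colour `i` of a measure on `𝔼`, as a measure on `ℝ^d`. -/
noncomputable def colour {d m : ℕ} (η : Measure (ColouredSpace d m)) (i : Fin m) :
    Measure (Space d) :=
  (η.restrict {p | p.2 = i}).map Prod.fst

/-- The intensity of colour `i`: the expected number of points of colour `i` per unit volume. For a
stationary process `∫ η^i(A) dμ(η)` is a multiple of the volume of `A`, and the cube `C_1` has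
volume `1`. -/
noncomputable def intensity {d m : ℕ} (μ : Measure (Measure (ColouredSpace d m))) (i : Fin m) :
    ℝ≥0∞ :=
  ∫⁻ η, colour η i (cube d 1) ∂μ

/-- `μ` is the law of a uniformly discrete `m`-coloured point process on `ℝ^d` that is stationary,
ergodic, and has positive intensity in every colour. The space of measures on `𝔼` carries the
`σ`-algebra generated by the evaluations `η ↦ η A`. -/
structure IsUniformlyDiscreteStationaryErgodic {d m : ℕ}
    (μ : Measure (Measure (ColouredSpace d m))) : Prop where
  isProbabilityMeasure : IsProbabilityMeasure μ
  uniformlyDiscrete : ∃ r : ℝ, 0 < r ∧ ∀ᵐ η ∂μ, η ∈ pointMeasures d m r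
  stationary : ∀ t : Space d, μ.map (translate t) = μ
  ergodic : ∀ D : Set (Measure (ColouredSpace d m)), MeasurableSet D →
    (∀ t : Space d, translate t ⁻¹' D = D) → μ D = 0 ∨ μ D = 1
  intensity_pos : ∀ i : Fin m, 0 < intensity μ i

/-- `η^w({x})`, where `η^w = ∑ i, w_i η^i` is the weighted version of `η`. -/
noncomputable def weightedMass {d m : ℕ} (w : Fin m → ℝ) (η : Measure (ColouredSpace d m))
    (x : Space d) : ℝ :=
  ∑ i, w i * (colour η i).real {x}

/-- The weighted counting function `N^w_f(η) = η^w(f) = ∑ i, w_i ∫ f dη^i`. -/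
noncomputable def weightedCount {d m : ℕ} (w : Fin m → ℝ) (f : Space d → ℂ)
    (η : Measure (ColouredSpace d m)) : ℂ :=
  ∑ i, (w i : ℂ) * ∫ x, f x ∂(colour η i)

/-- The Palm measure of the points of colour `i`:
`D ↦ ∫ ∑_{x ∈ C_1} η^i({x}) 1_D(T_{-x} η) dμ(η)`, where the cube `C_1` has volume `1`. -/
noncomputable def palm {d m : ℕ} (μ : Measure (Measure (ColouredSpace d m))) (i : Fin m) :
    Measure (Measure (ColouredSpace d m)) :=
  μ.bind fun η => ((colour η i).restrict (cube d 1)).map fun x => translate (-x) η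

/-- The integral of `F` against the weighted Palm measure `∑ i, w_i (palm μ i)`, which is a signed
measure. -/
noncomputable def weightedPalmIntegral {d m : ℕ} (μ : Measure (Measure (ColouredSpace d m)))
    (w : Fin m → ℝ) (F : Measure (ColouredSpace d m) → ℂ) : ℂ :=
  ∑ i, (w i : ℂ) * ∫ η, F η ∂(palm μ i)

/-- The weighted first moment of the weighted Palm measure, as a functional on functions on `ℝ^d`:
`f` is sent to the integral of `N^w_f` against the weighted Palm measure. -/
noncomputable def weightedFirstMoment {d m : ℕ} (μ : Measure (Measure (ColouredSpace d m)))
    (w : Fin m → ℝ) (f : Space d → ℂ) : ℂ :=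
  weightedPalmIntegral μ w (weightedCount w f)

/-- The positive Radon measure `ν` is the Fourier transform of the (signed) measure `ω`, given as a
functional: `ν(f) = ω(f̂)` for all rapidly decreasing `f`, with
`f̂(y) = ∫ exp(-2πi y·x) f(x) dx`. -/
structure IsFourierTransform {d : ℕ} (ω : (Space d → ℂ) → ℂ) (ν : Measure (Space d)) : Prop where
  isLocallyFinite : IsLocallyFiniteMeasure ν
  integrable : ∀ f : 𝓢(Space d, ℂ), Integrable (fun x => f x) ν
  integral_eq : ∀ f : 𝓢(Space d, ℂ), ∫ x, f x ∂ν = ω (fun y => (𝓕 f : 𝓢(Space d, ℂ)) y)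

/-- The isometric linear map `θ : L²(ℝ^d, ν) → L²(μ)` extends the assignment `f̂ ↦ N^w_f`,
`f` rapidly decreasing. -/
def IsDiffractionEmbedding {d m : ℕ} (μ : Measure (Measure (ColouredSpace d m))) (w : Fin m → ℝ)
    (ν : Measure (Space d)) (θ : Lp ℂ 2 ν →ₗᵢ[ℂ] Lp ℂ 2 μ) : Prop :=
  ∀ f : 𝓢(Space d, ℂ), ∃ hf : MemLp (fun y => (𝓕 f : 𝓢(Space d, ℂ)) y) 2 ν,
    θ (hf.toLp _) =ᵐ[μ] weightedCount w f

/-- The character `χ_k(x) = exp(2πi k·x)`. -/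
noncomputable def character {d : ℕ} (k x : Space d) : ℂ :=
  Complex.exp (2 * Real.pi * Complex.I * (inner ℝ k x : ℝ))

theorem norm_character {d : ℕ} (k x : Space d) : ‖character k x‖ = 1 := by
  have h : (2 * Real.pi * Complex.I * (inner ℝ k x : ℝ) : ℂ)
      = ((2 * Real.pi * inner ℝ k x : ℝ) : ℂ) * Complex.I := by
    push_cast; ring
  rw [character, h, Complex.norm_exp_ofReal_mul_I]

theorem continuous_character {d : ℕ} (k : Space d) : Continuous (character k) := by
  unfold character
  fun_prop

theorem memLp_character_mul {d : ℕ} {ν : Measure (Space d)} (k : Space d) {f : Space d → ℂ}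
    (hf : MemLp f 2 ν) : MemLp (fun x => character k x * f x) 2 ν :=
  hf.of_le ((continuous_character k).aestronglyMeasurable.mul hf.1)
    (Eventually.of_forall fun x => by rw [norm_mul, norm_character, one_mul])

/-- The representation `U` of `ℝ^d` on `L²(ℝ^d, ν)`:
`(U_t f)(x) = exp(-2πi t·x) f(x) = χ_{-t}(x) f(x)`. -/
noncomputable def U {d : ℕ} (ν : Measure (Space d)) (t : Space d) :
    Lp ℂ 2 ν →ₗ[ℂ] Lp ℂ 2 ν where
  toFun f := (memLp_character_mul (-t) (Lp.memLp f)).toLp _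
  map_add' f g := by
    rw [← MemLp.toLp_add]
    apply MemLp.toLp_congr
    filter_upwards [Lp.coeFn_add f g] with x hx
    simp only [hx, Pi.add_apply, mul_add]
  map_smul' c f := by
    rw [RingHom.id_apply, ← MemLp.toLp_const_smul]
    apply MemLp.toLp_congr
    filter_upwards [Lp.coeFn_smul c f] with x hx
    simp only [hx, Pi.smul_apply, smul_eq_mul]
    ring

/-- `k` is an eigenvalue of `U`: some nonzero `f ∈ L²(ℝ^d, ν)` satisfies `U_t f = χ_k(t) f` for all
`t`. -/
def IsEigenvalue {d : ℕ} (ν : Measure (Space d)) (k : Space d) : Prop :=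
  ∃ f : Lp ℂ 2 ν, f ≠ 0 ∧ ∀ t : Space d, U ν t f = character k t • f

/-- The average `(1 / ℓ(C_R)) ∑_{x ∈ C_R} η^w({x}) exp(2πi k·x)`. -/
noncomputable def average {d m : ℕ} (w : Fin m → ℝ) (k : Space d) (R : ℝ)
    (η : Measure (ColouredSpace d m)) : ℂ :=
  ((volume.real (cube d R) : ℝ) : ℂ)⁻¹ *
    ∑' x : cube d R, (weightedMass w η x : ℂ) * character k x

/-- The indicator function of `{k}` belongs to `L²` of a Radon measure. -/
theorem memLp_indicator_singleton {d : ℕ} {ω : (Space d → ℂ) → ℂ} {ν : Measure (Space d)}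
    (hν : IsFourierTransform ω ν) (k : Space d) :
    MemLp (Set.indicator {k} fun _ : Space d => (1 : ℂ)) 2 ν := by
  have := hν.isLocallyFinite
  exact memLp_indicator_const 2 (measurableSet_singleton k) 1
    (Or.inr (isCompact_singleton.measure_lt_top (μ := ν)).ne)

end ColouredPointProcess

/-!
Uniform discreteness bounds the number of points of `η` in a bounded set, so the counting functions
`N^w_f` of rapidly decreasing `f` belong to `L²(μ)`. By stationarity, the second moment of `N^w_f`
is the first moment of the Palm measure at the autocorrelation of `f`, which is the Fourier
transform of `|f̂|²`. Hence the functional that sends `φ` to the first moment at `φ̂` is nonnegative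
on the functions `|φ|²`. As in the Bochner–Schwartz theorem it is therefore integration against a
positive measure `ν`, and `f̂ ↦ N^w_f` preserves the `L²` norm, so that it extends to `θ` by
density.

For the averages, let `φ` be a rapidly decreasing function close to the indicator function of `C_1`
in `L¹`. Up to an error which is small in `L²(μ)` uniformly in large `R`, the average over `C_R` is
`N^w_f` for `f(x) = R^{-d} χ_k(x) φ(x / R)`, that is, `θ` applied to `y ↦ φ̂(R (y - k))`. As
`R → ∞` the latter converges to `φ̂(0) 1_{k}` in `L²(ν)`, and `φ̂(0)` is close to the volume `1` of
`C_1`.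
-/

namespace ColouredPointProcess

open ProbabilityTheory
open scoped NNReal ComplexConjugate

section TranslationBounded

open Metric

variable {E : Type*} [NormedAddCommGroup E] [MeasurableSpace E]

/-- Translation boundedness of a measure, with explicit constants: balls of radius `ρ` have mass at
most `K`. -/
def TranslationBounded (ρ : ℝ) (K : ℝ≥0) (ν : Measure E) : Prop :=
  ∀ a, ν (ball a ρ) ≤ K

theorem TranslationBounded.isLocallyFiniteMeasure {ρ : ℝ} {K : ℝ≥0} {ν : Measure E}
    (h : TranslationBounded ρ K ν) (hρ : 0 < ρ) : IsLocallyFiniteMeasure ν :=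
  ⟨fun x => ⟨ball x ρ, ball_mem_nhds x hρ, (h x).trans_lt ENNReal.coe_lt_top⟩⟩

variable [InnerProductSpace ℝ E] [FiniteDimensional ℝ E] [BorelSpace E]

theorem volume_ball_mul_lintegral {ν : Measure E} [SFinite ν] (ρ : ℝ) {f : E → ℝ≥0∞}
    (hf : Measurable f) :
    volume (ball (0 : E) ρ) * ∫⁻ x, f x ∂ν = ∫⁻ a, ∫⁻ x in ball a ρ, f x ∂ν := by
  classical
  set s := {p : E × E | dist p.1 p.2 < ρ}
  have hs : MeasurableSet s := (isOpen_lt continuous_dist continuous_const).measurableSet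
  calc volume (ball (0 : E) ρ) * ∫⁻ x, f x ∂ν
      = ∫⁻ x, ∫⁻ a, s.indicator (fun p => f p.1) (x, a) ∂volume ∂ν := by
        rw [← lintegral_const_mul _ hf]
        refine lintegral_congr fun x => ?_
        rw [← Measure.addHaar_ball_center volume x, mul_comm,
          ← lintegral_indicator_const isOpen_ball.measurableSet]
        simp only [s, Set.indicator_apply, mem_ball', Set.mem_ofPred_eq]
    _ = ∫⁻ a, ∫⁻ x, s.indicator (fun p => f p.1) (x, a) ∂ν ∂volume :=
        lintegral_lintegral_swap (f := fun x a => s.indicator (fun p => f p.1) (x, a))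
          ((hf.comp measurable_fst).indicator hs).aemeasurable
    _ = ∫⁻ a, ∫⁻ x in ball a ρ, f x ∂ν := by
        refine lintegral_congr fun a => ?_
        rw [← lintegral_indicator isOpen_ball.measurableSet]
        simp only [s, Set.indicator_apply, mem_ball, Set.mem_ofPred_eq]

theorem TranslationBounded.lintegral_le {ρ : ℝ} {K : ℝ≥0} {ν : Measure E}
    (h : TranslationBounded ρ K ν) (hρ : 0 < ρ) {f g : E → ℝ≥0∞} (hf : Measurable f)
    (hfg : ∀ x a, dist x a < ρ → f x ≤ g a) :
    ∫⁻ x, f x ∂ν ≤ K / volume (ball (0 : E) ρ) * ∫⁻ a, g a := by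
  have := h.isLocallyFiniteMeasure hρ
  have hV : volume (ball (0 : E) ρ) ≠ 0 := (measure_ball_pos volume _ hρ).ne'
  rw [← ENNReal.mul_div_right_comm, ENNReal.le_div_iff_mul_le (.inl hV)
    (.inl measure_ball_lt_top.ne), mul_comm, volume_ball_mul_lintegral ρ hf,
    ← lintegral_const_mul' _ _ ENNReal.coe_ne_top]
  refine lintegral_mono fun a => ?_
  calc ∫⁻ x in ball a ρ, f x ∂ν ≤ ∫⁻ _ in ball a ρ, g a ∂ν :=
        setLIntegral_mono measurable_const fun x hx => hfg x a hx
    _ ≤ K * g a := by rw [setLIntegral_const, mul_comm]; gcongr; exact h a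

theorem TranslationBounded.measure_le {ρ : ℝ} {K : ℝ≥0} {ν : Measure E}
    (h : TranslationBounded ρ K ν) (hρ : 0 < ρ) {s : Set E} (hs : MeasurableSet s) :
    ν s ≤ K / volume (ball (0 : E) ρ) * volume (thickening ρ s) := by
  rw [← lintegral_indicator_one hs, ← lintegral_indicator_one isOpen_thickening.measurableSet]
  refine h.lintegral_le hρ (measurable_one.indicator hs) fun x a hxa => ?_
  by_cases hx : x ∈ s
  · rw [Set.indicator_of_mem hx,
      Set.indicator_of_mem (mem_thickening_iff.2 ⟨x, hx, dist_comm a x ▸ hxa⟩), Pi.one_apply,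
      Pi.one_apply]
  · rw [Set.indicator_of_notMem hx]
    exact zero_le

variable (E) in
theorem exists_measure_ball_le {ρ : ℝ} (hρ : 0 < ρ) (K : ℝ≥0) (R : ℝ) :
    ∃ C : ℝ≥0, ∀ ν : Measure E, TranslationBounded ρ K ν → ν (ball 0 R) ≤ C := by
  have hfin : K / volume (ball (0 : E) ρ) * volume (thickening ρ (ball (0 : E) R)) ≠ ∞ :=
    ENNReal.mul_ne_top (ENNReal.div_ne_top ENNReal.coe_ne_top (measure_ball_pos volume _ hρ).ne')
      isBounded_ball.thickening.measure_lt_top.ne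
  exact ⟨ENNReal.toNNReal _, fun ν h =>
    (h.measure_le hρ isOpen_ball.measurableSet).trans_eq (ENNReal.coe_toNNReal hfin).symm⟩

end TranslationBounded

section DecayWeight

variable {E : Type*} [NormedAddCommGroup E] [InnerProductSpace ℝ E]

/-- A positive function that is integrable against every translation bounded measure and dominates
every rapidly decreasing function up to a factor. -/
noncomputable def decayWeight (x : E) : ℝ := (1 + ‖x‖) ^ (-(Module.finrank ℝ E + 1 : ℝ))

theorem decayWeight_pos (x : E) : 0 < decayWeight x := by unfold decayWeight; positivity

theorem continuous_decayWeight : Continuous (decayWeight (E := E)) :=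
  Continuous.rpow_const (by fun_prop) fun x => Or.inl (by positivity)

theorem decayWeight_le_of_dist_lt {ρ : ℝ} {x a : E} (h : dist x a < ρ) :
    decayWeight x ≤ (1 + ρ) ^ (Module.finrank ℝ E + 1 : ℝ) * decayWeight a := by
  have hρ : 0 < ρ := dist_nonneg.trans_lt h
  have hxa : ‖a‖ ≤ ‖x‖ + ρ := by
    linarith [norm_sub_norm_le a x, dist_eq_norm x a, norm_sub_rev x a]
  unfold decayWeight
  rw [Real.rpow_neg (by positivity), Real.rpow_neg (by positivity), ← div_eq_mul_inv,
    inv_le_comm₀ (by positivity) (by positivity), inv_div, div_le_iff₀ (by positivity),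
    ← Real.mul_rpow (by positivity) (by positivity)]
  exact Real.rpow_le_rpow (by positivity) (by nlinarith [norm_nonneg x]) (by positivity)

theorem norm_le_seminorm_mul_decayWeight (f : 𝓢(E, ℂ)) (x : E) :
    ‖f x‖ ≤ 2 ^ (Module.finrank ℝ E + 1) * (Finset.Iic ((Module.finrank ℝ E + 1, 0) : ℕ × ℕ)).sup
      (fun p => SchwartzMap.seminorm ℂ p.1 p.2) f * decayWeight x := by
  have h := SchwartzMap.one_add_le_sup_seminorm_apply (𝕜 := ℂ)
    (m := (Module.finrank ℝ E + 1, 0)) le_rfl le_rfl f x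
  rw [norm_iteratedFDeriv_zero] at h
  rw [decayWeight, Real.rpow_neg (by positivity), ← div_eq_mul_inv, le_div_iff₀ (by positivity),
    mul_comm]
  exact_mod_cast h

theorem exists_norm_le_decayWeight (f : 𝓢(E, ℂ)) : ∃ B, ∀ x, ‖f x‖ ≤ B * decayWeight x :=
  ⟨_, norm_le_seminorm_mul_decayWeight f⟩

variable [FiniteDimensional ℝ E] [MeasurableSpace E] [BorelSpace E]

theorem lintegral_decayWeight_lt_top : ∫⁻ x : E, ENNReal.ofReal (decayWeight x) < ∞ :=
  finite_integral_one_add_norm (lt_add_one _)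

variable (E) in
theorem exists_lintegral_decayWeight_le {ρ : ℝ} (hρ : 0 < ρ) (K : ℝ≥0) :
    ∃ C : ℝ≥0, ∀ ν : Measure E, TranslationBounded ρ K ν → ∀ b,
      ∫⁻ x, ENNReal.ofReal (decayWeight (x - b)) ∂ν ≤ C := by
  set A := ENNReal.ofReal ((1 + ρ) ^ (Module.finrank ℝ E + 1 : ℝ))
  set C := K / volume (Metric.ball (0 : E) ρ) * (A * ∫⁻ x : E, ENNReal.ofReal (decayWeight x))
  have hC : C ≠ ∞ :=
    ENNReal.mul_ne_top
      (ENNReal.div_ne_top ENNReal.coe_ne_top (Metric.measure_ball_pos volume _ hρ).ne')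
      (ENNReal.mul_ne_top ENNReal.ofReal_ne_top lintegral_decayWeight_lt_top.ne)
  refine ⟨C.toNNReal, fun ν h b => ?_⟩
  rw [ENNReal.coe_toNNReal hC]
  have hmeas : Measurable fun x : E => ENNReal.ofReal (decayWeight (x - b)) :=
    (continuous_decayWeight.comp (continuous_id.sub continuous_const)).measurable.ennreal_ofReal
  calc ∫⁻ x, ENNReal.ofReal (decayWeight (x - b)) ∂ν
      ≤ K / volume (Metric.ball (0 : E) ρ) * ∫⁻ a, A * ENNReal.ofReal (decayWeight (a - b)) := by
        refine h.lintegral_le hρ hmeas fun x a hxa => ?_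
        rw [← ENNReal.ofReal_mul (by positivity)]
        exact ENNReal.ofReal_le_ofReal (decayWeight_le_of_dist_lt (by simpa using hxa))
    _ = C := by
        rw [lintegral_const_mul _ hmeas,
          lintegral_sub_right_eq_self (fun x => ENNReal.ofReal (decayWeight x)) b]

end DecayWeight

section Sparse

open Metric

theorem measurableSet_translationBounded {E : Type*} [NormedAddCommGroup E] [MeasurableSpace E]
    [OpensMeasurableSpace E] [SecondCountableTopology E] (ρ : ℝ) (K : ℝ≥0) :
    MeasurableSet {ν : Measure E | TranslationBounded ρ K ν} := by
  let D := TopologicalSpace.denseSeq E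
  have hiff : {ν : Measure E | TranslationBounded ρ K ν} =
      ⋂ (n : ℕ) (j : ℕ), {ν : Measure E | ν (ball (D n) (ρ - 1 / (j + 1))) ≤ (K : ℝ≥0∞)} := by
    ext ν
    simp only [Set.mem_ofPred_eq, Set.mem_iInter]
    refine ⟨fun h n j => (measure_mono (ball_subset_ball ?_)).trans (h _), fun h a => ?_⟩
    · linarith [one_div_pos.2 (Nat.cast_add_one_pos (α := ℝ) j)]
    have hmono : Monotone fun j : ℕ => ball a (ρ - 2 * (1 / (j + 1 : ℝ))) := fun i j hij =>
      ball_subset_ball (by gcongr)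
    have hU : ball a ρ = ⋃ j : ℕ, ball a (ρ - 2 * (1 / (j + 1 : ℝ))) := by
      ext x
      simp only [Set.mem_iUnion, mem_ball]
      refine ⟨fun hx => ?_, fun ⟨j, hj⟩ => hj.trans (sub_lt_self _ (by positivity))⟩
      obtain ⟨j, hj⟩ := exists_nat_one_div_lt (half_pos (sub_pos.2 hx))
      exact ⟨j, by linarith⟩
    rw [hU, hmono.measure_iUnion]
    refine iSup_le fun j => ?_
    obtain ⟨n, hn⟩ := (TopologicalSpace.denseRange_denseSeq E).exists_dist_lt a
      (one_div_pos.2 (Nat.cast_add_one_pos (α := ℝ) j))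
    refine (measure_mono (ball_subset_ball' ?_)).trans (h n j)
    linarith
  rw [hiff]
  exact MeasurableSet.iInter fun n => MeasurableSet.iInter fun j =>
    measurableSet_le (Measure.measurable_coe isOpen_ball.measurableSet) measurable_const

variable {d m : ℕ} {ρ : ℝ} {η : Measure (ColouredSpace d m)} {i : Fin m}

/-- `η` gives mass at most one to the points with position in a ball of radius `ρ`, all colours
taken together. The configurations with this property form a measurable set, on which `η ↦ η` is an
s-finite kernel. -/
def Sparse (ρ : ℝ) (η : Measure (ColouredSpace d m)) : Prop :=
  TranslationBounded ρ 1 (η.map Prod.fst)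

theorem measurableSet_sparse (d m : ℕ) (ρ : ℝ) :
    MeasurableSet {η : Measure (ColouredSpace d m) | Sparse ρ η} :=
  Measure.measurable_map _ measurable_fst (measurableSet_translationBounded ρ 1)

theorem Sparse.zero : Sparse ρ (0 : Measure (ColouredSpace d m)) := fun a => by
  rw [Measure.map_zero, Measure.coe_zero, Pi.zero_apply]
  exact zero_le

theorem Sparse.of_mem_pointMeasures {r : ℝ} (h : η ∈ pointMeasures d m r) : Sparse (r / 2) η := by
  obtain ⟨Λ, hΛ, rfl⟩ := h
  intro a
  have hm : MeasurableSet (Prod.fst ⁻¹' ball a (r / 2) : Set (ColouredSpace d m)) :=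
    measurable_fst isOpen_ball.measurableSet
  rw [Measure.map_apply measurable_fst isOpen_ball.measurableSet, Measure.sum_apply _ hm]
  simp_rw [Measure.dirac_apply' _ hm]
  have hball_subset_cube : ∀ p ∈ Λ, p.1 ∈ ball a (r / 2) → p ∈ {p ∈ Λ | p.1 - a ∈ cube d r} :=
    fun p hp hpa => ⟨hp, fun j =>
      (PiLp.norm_apply_le (p.1 - a) j).trans_lt (by rwa [mem_ball, dist_eq_norm] at hpa)⟩
  have huniq := Set.encard_le_one_iff.1 (hΛ a)
  by_cases hex : ∃ p : Λ, p.1.1 ∈ ball a (r / 2)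
  · obtain ⟨p, hp⟩ := hex
    rw [tsum_eq_single p fun q hq => Set.indicator_of_notMem (s := Prod.fst ⁻¹' _)
      (fun hqa => hq (Subtype.ext (huniq _ _ (hball_subset_cube q q.2 hqa)
        (hball_subset_cube p p.2 hp)))) _]
    exact Set.indicator_le_self' (fun _ _ => zero_le_one) _
  · push Not at hex
    rw [ENNReal.tsum_eq_zero.2 fun q => Set.indicator_of_notMem (s := Prod.fst ⁻¹' _) (hex q) _]
    exact zero_le

theorem measurable_translate (t : Space d) : Measurable (translate (m := m) t) :=
  Measure.measurable_map _ (by fun_prop)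

theorem translate_translate (s t : Space d) (η : Measure (ColouredSpace d m)) :
    translate s (translate t η) = translate (s + t) η := by
  unfold translate
  rw [Measure.map_map (by fun_prop) (by fun_prop)]
  congr 1
  ext p : 2 <;> simp only [Function.comp_apply, add_assoc]

theorem colour_translate (t : Space d) (η : Measure (ColouredSpace d m)) (i : Fin m) :
    colour (translate t η) i = (colour η i).map (t + ·) := by
  have hi : MeasurableSet {p : ColouredSpace d m | p.2 = i} :=
    measurable_snd (measurableSet_singleton i)
  unfold translate colour
  rw [Measure.restrict_map (by fun_prop) hi,
    Measure.map_map (by fun_prop) (by fun_prop), Measure.map_map (by fun_prop) (by fun_prop)]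
  rfl

theorem Sparse.translate (h : Sparse ρ η) (t : Space d) : Sparse ρ (translate t η) := by
  intro a
  have hmap : (ColouredPointProcess.translate t η).map Prod.fst = (η.map Prod.fst).map (t + ·) := by
    rw [ColouredPointProcess.translate, Measure.map_map measurable_fst (by fun_prop),
      Measure.map_map (by fun_prop) measurable_fst]
    rfl
  rw [hmap, Measure.map_apply (by fun_prop) isOpen_ball.measurableSet, preimage_add_ball]
  exact h _

theorem Sparse.colour (h : Sparse ρ η) (i : Fin m) : TranslationBounded ρ 1 (colour η i) :=
  fun a => (Measure.map_mono Measure.restrict_le_self measurable_fst _).trans (h a)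

/-- The kernel that sends a sparse measure on `𝔼` to itself, and every other measure to `0`. -/
noncomputable def sparseKernel (d m : ℕ) (ρ : ℝ) :
    Kernel (Measure (ColouredSpace d m)) (ColouredSpace d m) :=
  open scoped Classical in
  Kernel.piecewise (measurableSet_sparse d m ρ) ⟨id, measurable_id⟩ 0

theorem sparseKernel_apply (h : Sparse ρ η) : sparseKernel d m ρ η = η := by
  classical
  rw [sparseKernel, Kernel.piecewise_apply, if_pos (Set.mem_ofPred_eq ▸ h)]
  rfl

theorem sparse_sparseKernel (ρ : ℝ) (η : Measure (ColouredSpace d m)) :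
    Sparse ρ (sparseKernel d m ρ η) := by
  classical
  rw [sparseKernel, Kernel.piecewise_apply]
  split_ifs with h
  · exact h
  · exact Sparse.zero

theorem isSFiniteKernel_of_forall_le {α β : Type*} [MeasurableSpace α] [MeasurableSpace β]
    (κ : Kernel α β) {s : ℕ → Set β} (hs : ∀ n, MeasurableSet (s n)) (hU : ⋃ n, s n = Set.univ)
    {c : ℕ → ℝ≥0} (hc : ∀ n a, κ a (s n) ≤ c n) : IsSFiniteKernel κ := by
  have hm : ∀ n, MeasurableSet (disjointed s n) := MeasurableSet.disjointed hs
  have hsum : κ = Kernel.sum fun n => κ.restrict (hm n) := by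
    ext a : 1
    simp_rw [Kernel.sum_apply, Kernel.restrict_apply]
    rw [← Measure.restrict_iUnion (disjoint_disjointed s) hm, iUnion_disjointed, hU,
      Measure.restrict_univ]
  rw [hsum]
  have : ∀ n, IsFiniteKernel (κ.restrict (hm n)) := fun n =>
    ⟨c n, ENNReal.coe_lt_top, fun a => by
      rw [Kernel.restrict_apply, Measure.restrict_apply_univ]
      exact (measure_mono (disjointed_subset s n)).trans (hc n a)⟩
  exact Kernel.isSFiniteKernel_sum

theorem isSFiniteKernel_sparseKernel (hρ : 0 < ρ) : IsSFiniteKernel (sparseKernel d m ρ) := by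
  choose c hc using fun n : ℕ => exists_measure_ball_le (Space d) hρ 1 n
  refine isSFiniteKernel_of_forall_le _ (s := fun n => Prod.fst ⁻¹' ball 0 n)
    (fun n => measurable_fst isOpen_ball.measurableSet) ?_ (c := c) fun n η => ?_
  · rw [← Set.preimage_iUnion, iUnion_ball_nat, Set.preimage_univ]
  · rw [← Measure.map_apply measurable_fst isOpen_ball.measurableSet]
    exact hc n _ (sparse_sparseKernel ρ η)

/-- The kernel `η ↦ η^i` on sparse measures. -/
noncomputable def colourKernel (d : ℕ) {m : ℕ} (ρ : ℝ) (i : Fin m) :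
    Kernel (Measure (ColouredSpace d m)) (Space d) :=
  ((sparseKernel d m ρ).restrict
    (measurable_snd (measurableSet_singleton i) : MeasurableSet (Prod.snd ⁻¹' {i}))).map Prod.fst

theorem isSFiniteKernel_colourKernel (hρ : 0 < ρ) (i : Fin m) :
    IsSFiniteKernel (colourKernel d ρ i) := by
  have := isSFiniteKernel_sparseKernel (d := d) (m := m) hρ
  unfold colourKernel
  infer_instance

theorem colourKernel_eq (η : Measure (ColouredSpace d m)) (i : Fin m) :
    colourKernel d ρ i η = colour (sparseKernel d m ρ η) i := by
  rw [colourKernel, Kernel.map_apply _ measurable_fst, Kernel.restrict_apply, colour]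
  rfl

theorem colourKernel_apply (h : Sparse ρ η) (i : Fin m) : colourKernel d ρ i η = colour η i := by
  rw [colourKernel_eq, sparseKernel_apply h]

/-- The configuration `T_{-x} η` seen from the point `x` of `η`. If `η` is not sparse, it is `0`,
which makes the map jointly measurable. -/
noncomputable def recentre (d m : ℕ) (ρ : ℝ) (q : Measure (ColouredSpace d m) × Space d) :
    Measure (ColouredSpace d m) := translate (-q.2) (sparseKernel d m ρ q.1)

theorem measurable_recentre (hρ : 0 < ρ) : Measurable (recentre d m ρ) := by
  have := isSFiniteKernel_sparseKernel (d := d) (m := m) hρ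
  let κ := (Kernel.id ×ₖ Kernel.prodMkRight (Space d) (sparseKernel d m ρ)).map
    fun z => ((-z.1.2 + z.2.1, z.2.2) : ColouredSpace d m)
  suffices h : recentre d m ρ = κ from h ▸ κ.measurable
  ext q : 1
  rw [Kernel.map_apply _ (by fun_prop), Kernel.prod_apply, Kernel.id_apply, Measure.dirac_prod,
    Measure.map_map (by fun_prop) (by fun_prop)]
  rfl

end Sparse

section Cube

variable {d : ℕ}

theorem isOpen_cube (R : ℝ) : IsOpen (cube d R) := by
  simp only [cube, Set.ofPred_forall]
  exact isOpen_iInter_of_finite fun j => isOpen_lt (by fun_prop) continuous_const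

theorem measurableSet_cube (R : ℝ) : MeasurableSet (cube d R) := (isOpen_cube R).measurableSet

theorem volume_cube (R : ℝ) : volume (cube d R) = ENNReal.ofReal R ^ d := by
  have h : cube d R = (MeasurableEquiv.toLp 2 (Fin d → ℝ)).symm ⁻¹'
      Set.pi Set.univ fun _ => Set.Ioo (-(R / 2)) (R / 2) := by
    ext x
    simp [cube, abs_lt, Set.mem_pi]
  rw [h, (EuclideanSpace.volume_preserving_symm_measurableEquiv_toLp _).measure_preimage_equiv,
    Real.volume_pi_Ioo, Finset.prod_const, Finset.card_univ, Fintype.card_fin, sub_neg_eq_add,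
    add_halves]

theorem norm_le_of_mem_cube {R : ℝ} (hR : 0 ≤ R) {x : Space d} (hx : x ∈ cube d R) :
    ‖x‖ ≤ d * R := by
  refine abs_le_of_sq_le_sq' ?_ (by positivity) |>.2
  rw [EuclideanSpace.norm_sq_eq]
  calc ∑ j, ‖x j‖ ^ 2 ≤ ∑ _j : Fin d, R ^ 2 :=
        Finset.sum_le_sum fun j _ => by
          rw [Real.norm_eq_abs]
          exact pow_le_pow_left₀ (abs_nonneg _) (by linarith [hx j]) 2
    _ = d * R ^ 2 := by rw [Finset.sum_const, Finset.card_univ, Fintype.card_fin, nsmul_eq_mul]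
    _ ≤ (d * R) ^ 2 := by
        rw [mul_pow]
        gcongr
        exact_mod_cast Nat.le_self_pow two_ne_zero d

theorem isBounded_cube (R : ℝ) : Bornology.IsBounded (cube d R) := by
  refine (Metric.isBounded_closedBall (x := (0 : Space d)) (r := d * |R|)).subset fun x hx => ?_
  rw [mem_closedBall_zero_iff]
  exact norm_le_of_mem_cube (abs_nonneg R)
    fun j => (hx j).trans_le (by linarith [le_abs_self R])

end Cube

section Campbell

theorem eq_prod_of_translation_invariant {E Ω : Type*} [AddCommGroup E] [MeasurableSpace E]
    [MeasurableAdd₂ E] [MeasurableNeg E] [MeasurableSpace Ω] {C : Measure (E × Ω)} [SFinite C]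
    (hC : ∀ a, C.map (fun p => (a + p.1, p.2)) = C) (vol : Measure E) [SFinite vol]
    [vol.IsAddLeftInvariant] [vol.IsNegInvariant] {Q : Set E} (hQ : MeasurableSet Q)
    (hvol : vol Q = 1) :
    C = vol.prod (C.restrict (Q ×ˢ Set.univ)).snd := by
  set q : E → ℝ≥0∞ := Q.indicator 1
  have hq : Measurable q := measurable_one.indicator hQ
  have hq_int : ∀ x, ∫⁻ a, q (x - a) ∂vol = 1 := fun x => by
    rw [lintegral_sub_left_eq_self q x, lintegral_indicator_one hQ, hvol]
  refine Measure.ext_of_lintegral _ fun g hg => ?_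
  calc ∫⁻ p, g p ∂C = ∫⁻ p, ∫⁻ a, q (p.1 - a) * g p ∂vol ∂C :=
        lintegral_congr fun p => by
          rw [lintegral_mul_const _ (by fun_prop), hq_int, one_mul]
    _ = ∫⁻ a, ∫⁻ p, q (p.1 - a) * g p ∂C ∂vol :=
        lintegral_lintegral_swap (by fun_prop)
    _ = ∫⁻ a, ∫⁻ p, q p.1 * g (a + p.1, p.2) ∂C ∂vol :=
        lintegral_congr fun a => by
          nth_rw 1 [← hC a]
          rw [lintegral_map (by fun_prop) (by fun_prop)]
          simp only [add_sub_cancel_left]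
    _ = ∫⁻ p, ∫⁻ a, q p.1 * g (a + p.1, p.2) ∂vol ∂C :=
        lintegral_lintegral_swap (by fun_prop)
    _ = ∫⁻ p, (Q ×ˢ Set.univ).indicator (fun p => ∫⁻ a, g (a, p.2) ∂vol) p ∂C :=
        lintegral_congr fun p => by
          rw [lintegral_const_mul _ (by fun_prop),
            lintegral_add_right_eq_self (fun a => g (a, p.2)) p.1]
          by_cases hp : p.1 ∈ Q <;> simp [q, hp]
    _ = ∫⁻ z, ∫⁻ a, g (a, z) ∂vol ∂(C.restrict (Q ×ˢ Set.univ)).snd := by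
        rw [lintegral_indicator (hQ.prod MeasurableSet.univ), Measure.snd,
          lintegral_map hg.lintegral_prod_left' measurable_snd]
    _ = ∫⁻ p, g p ∂(vol.prod (C.restrict (Q ×ˢ Set.univ)).snd) :=
        (lintegral_prod_symm' _ hg).symm

variable {d m : ℕ} {ρ : ℝ} {μ : Measure (Measure (ColouredSpace d m))}

/-- The Campbell measure of the points of colour `i`, which records the position `x` of a point
together with the configuration `T_{-x} η` seen from it. -/
noncomputable def campbell (ρ : ℝ) (μ : Measure (Measure (ColouredSpace d m))) (i : Fin m) :
    Measure (Space d × Measure (ColouredSpace d m)) :=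
  (μ ⊗ₘ colourKernel d ρ i).map fun q => (q.2, recentre d m ρ q)

theorem measurable_snd_prodMk_recentre (hρ : 0 < ρ) :
    Measurable fun q : Measure (ColouredSpace d m) × Space d => (q.2, recentre d m ρ q) :=
  measurable_snd.prodMk (measurable_recentre hρ)

theorem aemeasurable_lintegral_colour (hρ : 0 < ρ) (hs : ∀ᵐ η ∂μ, Sparse ρ η) (i : Fin m)
    {g : Space d × Measure (ColouredSpace d m) → ℝ≥0∞} (hg : Measurable g) :
    AEMeasurable (fun η => ∫⁻ x, g (x, translate (-x) η) ∂(colour η i)) μ := by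
  have := isSFiniteKernel_colourKernel (d := d) hρ i
  refine ⟨fun η => ∫⁻ x, g (x, recentre d m ρ (η, x)) ∂(colourKernel d ρ i η),
    (hg.comp (measurable_snd_prodMk_recentre hρ)).lintegral_kernel_prod_right', ?_⟩
  filter_upwards [hs] with η hη
  simp only [colourKernel_apply hη, recentre, sparseKernel_apply hη]

theorem lintegral_campbell [SFinite μ] (hρ : 0 < ρ) (hs : ∀ᵐ η ∂μ, Sparse ρ η) (i : Fin m)
    {g : Space d × Measure (ColouredSpace d m) → ℝ≥0∞} (hg : Measurable g) :
    ∫⁻ p, g p ∂(campbell ρ μ i) = ∫⁻ η, ∫⁻ x, g (x, translate (-x) η) ∂(colour η i) ∂μ := by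
  have := isSFiniteKernel_colourKernel (d := d) hρ i
  have hm := measurable_snd_prodMk_recentre (d := d) (m := m) hρ
  rw [campbell, lintegral_map hg hm]
  refine (Measure.lintegral_compProd (hg.comp hm)).trans (lintegral_congr_ae ?_)
  filter_upwards [hs] with η hη
  simp only [Function.comp_apply, colourKernel_apply hη, recentre, sparseKernel_apply hη]

theorem campbell_map_add [SFinite μ] (hρ : 0 < ρ) (hs : ∀ᵐ η ∂μ, Sparse ρ η)
    (hst : ∀ t, μ.map (translate t) = μ) (i : Fin m) (a : Space d) :
    (campbell ρ μ i).map (fun p => (a + p.1, p.2)) = campbell ρ μ i := by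
  have hadd : Measurable fun p : Space d × Measure (ColouredSpace d m) => (a + p.1, p.2) := by
    fun_prop
  refine Measure.ext_of_lintegral _ fun g hg => ?_
  calc ∫⁻ p, g p ∂(campbell ρ μ i).map (fun p => (a + p.1, p.2))
      = ∫⁻ η, ∫⁻ x, g (a + x, translate (-x) η) ∂(colour η i) ∂μ :=
        (lintegral_map hg hadd).trans (lintegral_campbell hρ hs i (hg.comp hadd))
    _ = ∫⁻ η, ∫⁻ x, g (x, translate (-x) (translate a η)) ∂(colour (translate a η) i) ∂μ :=
        lintegral_congr fun η => by
          rw [colour_translate]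
          refine Eq.trans ?_ ((MeasurableEquiv.addLeft a).measurableEmbedding.lintegral_map _).symm
          simp only [MeasurableEquiv.coe_addLeft, translate_translate, neg_add_rev,
            neg_add_cancel_right]
    _ = ∫⁻ η, ∫⁻ x, g (x, translate (-x) η) ∂(colour η i) ∂μ := by
        have h := aemeasurable_lintegral_colour hρ hs i hg
        rw [← hst a] at h
        rw [← lintegral_map' h (measurable_translate a).aemeasurable, hst a]
    _ = ∫⁻ p, g p ∂(campbell ρ μ i) := (lintegral_campbell hρ hs i hg).symm

theorem lintegral_palm (hρ : 0 < ρ) (hs : ∀ᵐ η ∂μ, Sparse ρ η) (i : Fin m)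
    {F : Measure (ColouredSpace d m) → ℝ≥0∞} (hF : Measurable F) :
    ∫⁻ ζ, F ζ ∂(palm μ i) = ∫⁻ η, ∫⁻ x in cube d 1, F (translate (-x) η) ∂(colour η i) ∂μ := by
  have := isSFiniteKernel_colourKernel (d := d) hρ i
  have hr := measurable_recentre (d := d) (m := m) hρ
  let κ := (Kernel.id ×ₖ (colourKernel d ρ i).restrict (measurableSet_cube 1)).map (recentre d m ρ)
  have hκ : ∀ η, κ η =
      ((colourKernel d ρ i η).restrict (cube d 1)).map fun x => recentre d m ρ (η, x) := fun η => by
    rw [Kernel.map_apply _ hr, Kernel.prod_apply, Kernel.id_apply, Kernel.restrict_apply,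
      Measure.dirac_prod, Measure.map_map hr measurable_prodMk_left]
    rfl
  have hpalm : palm μ i = μ.bind κ := Measure.bind_congr_right <| by
    filter_upwards [hs] with η hη
    simp only [hκ, colourKernel_apply hη, recentre, sparseKernel_apply hη]
  rw [hpalm, Measure.lintegral_bind κ.aemeasurable hF.aemeasurable]
  refine lintegral_congr_ae ?_
  filter_upwards [hs] with η hη
  have hrη : Measurable fun x => recentre d m ρ (η, x) := hr.comp measurable_prodMk_left
  rw [hκ, lintegral_map hF hrη]
  simp only [colourKernel_apply hη, recentre, sparseKernel_apply hη]

theorem palm_eq_snd_campbell [SFinite μ] (hρ : 0 < ρ) (hs : ∀ᵐ η ∂μ, Sparse ρ η) (i : Fin m) :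
    palm μ i = ((campbell ρ μ i).restrict (cube d 1 ×ˢ Set.univ)).snd := by
  have hQ : MeasurableSet (cube d 1 ×ˢ (Set.univ : Set (Measure (ColouredSpace d m)))) :=
    (measurableSet_cube 1).prod MeasurableSet.univ
  refine Measure.ext_of_lintegral _ fun F hF => ?_
  rw [lintegral_palm hρ hs i hF, Measure.snd, lintegral_map hF measurable_snd,
    ← lintegral_indicator hQ]
  refine .symm <| (lintegral_campbell hρ hs i ((hF.comp measurable_snd).indicator hQ)).trans <|
    lintegral_congr fun η => ?_
  rw [← lintegral_indicator (measurableSet_cube 1)]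
  refine lintegral_congr fun x => ?_
  by_cases hx : x ∈ cube d 1 <;> simp [hx]

theorem campbell_eq_prod [SFinite μ] (hρ : 0 < ρ) (hs : ∀ᵐ η ∂μ, Sparse ρ η)
    (hst : ∀ t, μ.map (translate t) = μ) (i : Fin m) :
    campbell ρ μ i = volume.prod (palm μ i) := by
  have := isSFiniteKernel_colourKernel (d := d) hρ i
  have : SFinite (campbell ρ μ i) := by unfold campbell; infer_instance
  rw [palm_eq_snd_campbell hρ hs]
  refine eq_prod_of_translation_invariant (campbell_map_add hρ hs hst i) volume
    (measurableSet_cube 1) ?_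
  rw [volume_cube, ENNReal.ofReal_one, one_pow]

theorem isFiniteMeasure_palm [IsFiniteMeasure μ] (hρ : 0 < ρ) (hs : ∀ᵐ η ∂μ, Sparse ρ η)
    (i : Fin m) : IsFiniteMeasure (palm μ i) := by
  obtain ⟨R, hR⟩ := (isBounded_cube (d := d) 1).subset_ball 0
  obtain ⟨C, hC⟩ := exists_measure_ball_le (Space d) hρ 1 R
  refine ⟨?_⟩
  calc palm μ i Set.univ = ∫⁻ η, colour η i (cube d 1) ∂μ := by
        rw [← lintegral_one, lintegral_palm hρ hs i measurable_const]
        simp_rw [setLIntegral_one]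
    _ ≤ ∫⁻ _, C ∂μ := by
        refine lintegral_mono_ae ?_
        filter_upwards [hs] with η hη
        exact (measure_mono hR).trans (hC _ (hη.colour i))
    _ < ∞ := by
        rw [lintegral_const]
        exact ENNReal.mul_lt_top ENNReal.coe_lt_top (measure_lt_top μ _)

theorem ae_palm_sparse (hρ : 0 < ρ) (hs : ∀ᵐ η ∂μ, Sparse ρ η) (i : Fin m) :
    ∀ᵐ ζ ∂(palm μ i), Sparse ρ ζ := by
  have hmeas := (measurableSet_sparse d m ρ).compl
  rw [ae_iff, ← Set.compl_ofPred, ← lintegral_indicator_one hmeas,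
    lintegral_palm hρ hs i (measurable_one.indicator hmeas)]
  refine lintegral_eq_zero_of_ae_eq_zero ?_
  filter_upwards [hs] with η hη
  exact (lintegral_congr fun x => Set.indicator_of_notMem
    (Set.notMem_compl_iff.2 (hη.translate (-x))) _).trans lintegral_zero

variable {F : Space d × Measure (ColouredSpace d m) → ℂ} {i : Fin m}

theorem integral_recentre_ae_eq (hs : ∀ᵐ η ∂μ, Sparse ρ η) :
    (fun η => ∫ x, F (x, recentre d m ρ (η, x)) ∂(colourKernel d ρ i η)) =ᵐ[μ]
      fun η => ∫ x, F (x, translate (-x) η) ∂(colour η i) := by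
  filter_upwards [hs] with η hη
  simp only [colourKernel_apply hη, recentre, sparseKernel_apply hη]

variable [IsFiniteMeasure μ]

theorem integrable_campbell (hρ : 0 < ρ) (hs : ∀ᵐ η ∂μ, Sparse ρ η)
    (hst : ∀ t, μ.map (translate t) = μ) (hF : Integrable F (volume.prod (palm μ i))) :
    Integrable (fun q => F (q.2, recentre d m ρ q)) (μ ⊗ₘ colourKernel d ρ i) := by
  rw [← campbell_eq_prod hρ hs hst, campbell] at hF
  exact hF.comp_measurable (measurable_snd_prodMk_recentre hρ)

theorem integrable_integral_campbell (hρ : 0 < ρ) (hs : ∀ᵐ η ∂μ, Sparse ρ η)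
    (hst : ∀ t, μ.map (translate t) = μ) (hF : Integrable F (volume.prod (palm μ i))) :
    Integrable (fun η => ∫ x, F (x, translate (-x) η) ∂(colour η i)) μ := by
  have := isSFiniteKernel_colourKernel (d := d) hρ i
  have h : Integrable (fun q => F (q.2, recentre d m ρ q))
      ((Kernel.const Unit μ ⊗ₖ Kernel.prodMkLeft Unit (colourKernel d ρ i)) ()) :=
    integrable_campbell hρ hs hst hF
  exact h.integral_compProd.congr (integral_recentre_ae_eq hs)

theorem integral_integral_campbell (hρ : 0 < ρ) (hs : ∀ᵐ η ∂μ, Sparse ρ η)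
    (hst : ∀ t, μ.map (translate t) = μ) (hF : Integrable F (volume.prod (palm μ i))) :
    ∫ η, ∫ x, F (x, translate (-x) η) ∂(colour η i) ∂μ =
      ∫ ζ, ∫ x, F (x, ζ) ∂volume ∂(palm μ i) := by
  have := isSFiniteKernel_colourKernel (d := d) hρ i
  have := isFiniteMeasure_palm hρ hs i
  rw [← integral_congr_ae (integral_recentre_ae_eq hs), ← integral_prod_symm _ hF,
    ← Measure.integral_compProd (integrable_campbell hρ hs hst hF), ← campbell_eq_prod hρ hs hst,
    campbell, integral_map (measurable_snd_prodMk_recentre hρ).aemeasurable]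
  rw [← campbell, campbell_eq_prod hρ hs hst]
  exact hF.aestronglyMeasurable

end Campbell

section Decay

variable {E : Type*} [NormedAddCommGroup E] [InnerProductSpace ℝ E] [FiniteDimensional ℝ E]
  [MeasurableSpace E] [BorelSpace E] {ρ B : ℝ} {K : ℝ≥0} {ν : Measure E}

theorem TranslationBounded.integrable_decayWeight (h : TranslationBounded ρ K ν) (hρ : 0 < ρ)
    (b : E) : Integrable (fun x => decayWeight (x - b)) ν := by
  obtain ⟨C, hC⟩ := exists_lintegral_decayWeight_le E hρ K
  refine ⟨(continuous_decayWeight.comp (continuous_sub_right b)).aestronglyMeasurable, ?_⟩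
  rw [hasFiniteIntegral_iff_ofReal (Eventually.of_forall fun x => (decayWeight_pos _).le)]
  exact (hC ν h b).trans_lt ENNReal.coe_lt_top

theorem TranslationBounded.integrable (h : TranslationBounded ρ K ν) (hρ : 0 < ρ) {f : E → ℂ}
    (hf : AEStronglyMeasurable f ν) {b : E} (hB : ∀ x, ‖f x‖ ≤ B * decayWeight (x - b)) :
    Integrable f ν :=
  ((h.integrable_decayWeight hρ b).const_mul B).mono' hf (Eventually.of_forall hB)

variable (E) in
theorem exists_integral_norm_le (hρ : 0 < ρ) (K : ℝ≥0) :
    ∃ C : ℝ≥0, ∀ ν : Measure E, TranslationBounded ρ K ν → ∀ (f : E → ℂ) (B : ℝ) (b : E),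
      (∀ x, ‖f x‖ ≤ B * decayWeight (x - b)) → ∫ x, ‖f x‖ ∂ν ≤ B * C := by
  obtain ⟨C, hC⟩ := exists_lintegral_decayWeight_le E hρ K
  refine ⟨C, fun ν h f B b hB => ?_⟩
  have hB0 : 0 ≤ B := nonneg_of_mul_nonneg_left ((norm_nonneg _).trans (hB 0)) (decayWeight_pos _)
  calc ∫ x, ‖f x‖ ∂ν ≤ ∫ x, B * decayWeight (x - b) ∂ν :=
        integral_mono_of_nonneg (Eventually.of_forall fun _ => norm_nonneg _)
          ((h.integrable_decayWeight hρ b).const_mul B) (Eventually.of_forall hB)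
    _ ≤ B * C := by
        rw [integral_const_mul, integral_eq_lintegral_of_nonneg_ae
          (Eventually.of_forall fun x => (decayWeight_pos _).le)
          (h.integrable_decayWeight hρ b).aestronglyMeasurable]
        gcongr
        exact ENNReal.toReal_mono ENNReal.coe_ne_top (hC ν h b)

theorem TranslationBounded.hasTemperateGrowth (h : TranslationBounded ρ K ν) (hρ : 0 < ρ) :
    ν.HasTemperateGrowth :=
  ⟨⟨Module.finrank ℝ E + 1, by simpa [decayWeight] using h.integrable_decayWeight hρ 0⟩⟩

end Decay

section WeightedCount

variable {d m : ℕ} {ρ B : ℝ} (w : Fin m → ℝ)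

theorem exists_norm_weightedCount_le (hρ : 0 < ρ) :
    ∃ C : ℝ, ∀ (η : Measure (ColouredSpace d m)), Sparse ρ η →
      ∀ (f : Space d → ℂ) (B : ℝ) (b : Space d), (∀ x, ‖f x‖ ≤ B * decayWeight (x - b)) →
        ‖weightedCount w f η‖ ≤ B * C := by
  obtain ⟨C, hC⟩ := exists_integral_norm_le (Space d) hρ 1
  refine ⟨(∑ i, |w i|) * C, fun η hη f B b hB => ?_⟩
  rw [weightedCount, mul_left_comm, Finset.sum_mul]
  refine norm_sum_le_of_le _ fun i _ => ?_
  rw [norm_mul, Complex.norm_real, Real.norm_eq_abs]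
  gcongr
  exact (norm_integral_le_integral_norm _).trans (hC _ (hη.colour i) f B b hB)

theorem aestronglyMeasurable_weightedCount {α : Type*} [MeasurableSpace α] {P : Measure α}
    {T : α → Measure (ColouredSpace d m)} (hT : Measurable T) (hP : ∀ᵐ a ∂P, Sparse ρ (T a))
    (hρ : 0 < ρ) {f : α × Space d → ℂ} (hf : Measurable f) :
    AEStronglyMeasurable (fun a => weightedCount w (fun x => f (a, x)) (T a)) P := by
  have := fun i : Fin m => isSFiniteKernel_colourKernel (d := d) hρ i
  have hmeas : ∀ i, StronglyMeasurable fun a =>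
      ∫ x, f (a, x) ∂((colourKernel d ρ i).comap T hT a) := fun i =>
    hf.stronglyMeasurable.integral_kernel_prod_right'
  refine ⟨fun a => ∑ i, (w i : ℂ) * ∫ x, f (a, x) ∂((colourKernel d ρ i).comap T hT a),
    Finset.stronglyMeasurable_fun_sum _ fun i _ => (hmeas i).const_mul _, ?_⟩
  filter_upwards [hP] with a ha
  simp only [weightedCount, Kernel.comap_apply, colourKernel_apply ha]

theorem memLp_weightedCount {P : Measure (Measure (ColouredSpace d m))} [IsFiniteMeasure P]
    (hP : ∀ᵐ η ∂P, Sparse ρ η) (hρ : 0 < ρ) {f : Space d → ℂ} (hf : Measurable f) {b : Space d}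
    (hB : ∀ x, ‖f x‖ ≤ B * decayWeight (x - b)) (p : ℝ≥0∞) : MemLp (weightedCount w f) p P := by
  obtain ⟨C, hC⟩ := exists_norm_weightedCount_le (d := d) w hρ
  have hmeas : AEStronglyMeasurable (weightedCount w f) P :=
    aestronglyMeasurable_weightedCount w measurable_id hP hρ (hf.comp measurable_snd)
  exact MemLp.of_bound hmeas (B * C) (hP.mono fun η hη => hC η hη f B b hB)

theorem memLp_weightedCount_schwartz {P : Measure (Measure (ColouredSpace d m))}
    [IsFiniteMeasure P] (hP : ∀ᵐ η ∂P, Sparse ρ η) (hρ : 0 < ρ) (f : 𝓢(Space d, ℂ)) (p : ℝ≥0∞) :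
    MemLp (weightedCount w f) p P := by
  obtain ⟨B, hB⟩ := exists_norm_le_decayWeight f
  exact memLp_weightedCount w hP hρ f.continuous.measurable (b := 0)
    (by simpa only [sub_zero] using hB) p

theorem weightedCount_add {η : Measure (ColouredSpace d m)} (hη : Sparse ρ η) (hρ : 0 < ρ)
    (f g : 𝓢(Space d, ℂ)) :
    weightedCount w (fun x => f x + g x) η = weightedCount w f η + weightedCount w g η := by
  have hint : ∀ (h : 𝓢(Space d, ℂ)) i, Integrable h (colour η i) := fun h i =>
    have := (hη.colour i).hasTemperateGrowth hρ
    h.integrable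
  simp only [weightedCount, integral_add (hint f _) (hint g _), mul_add, Finset.sum_add_distrib]

theorem weightedCount_const_mul (η : Measure (ColouredSpace d m)) (c : ℂ) (f : Space d → ℂ) :
    weightedCount w (fun x => c * f x) η = c * weightedCount w f η := by
  simp only [weightedCount, integral_const_mul, Finset.mul_sum, mul_left_comm]

theorem weightedCount_conj (η : Measure (ColouredSpace d m)) (f : Space d → ℂ) :
    weightedCount w (fun x => conj (f x)) η = conj (weightedCount w f η) := by
  simp only [weightedCount, integral_conj, map_sum, map_mul, Complex.conj_ofReal]

theorem weightedCount_translate (η : Measure (ColouredSpace d m)) (t : Space d)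
    (f : Space d → ℂ) :
    weightedCount w f (translate t η) = weightedCount w (fun x => f (t + x)) η := by
  simp only [weightedCount, colour_translate]
  refine Finset.sum_congr rfl fun i _ => congrArg _ ?_
  exact (MeasurableEquiv.addLeft t).measurableEmbedding.integral_map f

end WeightedCount

section SecondMoment

variable {d m : ℕ} {ρ : ℝ} {μ : Measure (Measure (ColouredSpace d m))} (w : Fin m → ℝ)

theorem integrable_mul_conj_comp_add {E : Type*} [NormedAddCommGroup E] [InnerProductSpace ℝ E]
    [FiniteDimensional ℝ E] [MeasurableSpace E] [BorelSpace E] {K : ℝ≥0} {ν : Measure E}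
    (hν : TranslationBounded ρ K ν) (hρ : 0 < ρ) (f g : 𝓢(E, ℂ)) :
    Integrable (fun p : E × E => f p.1 * conj (g (p.1 + p.2))) (volume.prod ν) := by
  have := hν.isLocallyFiniteMeasure hρ
  obtain ⟨C, hC⟩ := exists_integral_norm_le E hρ K
  obtain ⟨B, hB⟩ := exists_norm_le_decayWeight g
  have hdecay : ∀ x z, ‖conj (g (x + z))‖ ≤ B * decayWeight (z - -x) := fun x z => by
    rw [RCLike.norm_conj, sub_neg_eq_add, add_comm z x]
    exact hB _
  have hcont : Continuous fun p : E × E => f p.1 * conj (g (p.1 + p.2)) := by fun_prop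
  rw [integrable_prod_iff hcont.aestronglyMeasurable]
  refine ⟨Eventually.of_forall fun x => (hν.integrable hρ
    (by fun_prop : Continuous fun z => conj (g (x + z))).aestronglyMeasurable (hdecay x)).const_mul
      (f x), ?_⟩
  refine (f.integrable.norm.mul_const (B * C)).mono'
    hcont.aestronglyMeasurable.norm.integral_prod_right' (Eventually.of_forall fun x => ?_)
  rw [Real.norm_of_nonneg (integral_nonneg fun _ => norm_nonneg _)]
  simp_rw [norm_mul]
  rw [integral_const_mul]
  gcongr
  exact hC ν hν _ B (-x) (hdecay x)

theorem integral_mul_conj_weightedCount {ζ : Measure (ColouredSpace d m)} (hζ : Sparse ρ ζ)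
    (hρ : 0 < ρ) (f g : 𝓢(Space d, ℂ)) :
    ∫ x, f x * conj (weightedCount w (fun z => g (x + z)) ζ) =
      weightedCount w (fun z => ∫ x, f x * conj (g (x + z))) ζ := by
  have hint : ∀ i, Integrable (fun p : Space d × Space d => f p.1 * conj (g (p.1 + p.2)))
      (volume.prod (colour ζ i)) := fun i => integrable_mul_conj_comp_add (hζ.colour i) hρ f g
  have := fun i => (hζ.colour i).isLocallyFiniteMeasure hρ
  calc ∫ x, f x * conj (weightedCount w (fun z => g (x + z)) ζ)
      = ∫ x, ∑ i, (w i : ℂ) * ∫ z, f x * conj (g (x + z)) ∂(colour ζ i) := by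
        simp_rw [← weightedCount_conj]
        simp only [weightedCount, Finset.mul_sum, integral_const_mul, mul_left_comm (f _)]
    _ = ∑ i, (w i : ℂ) * ∫ x, ∫ z, f x * conj (g (x + z)) ∂(colour ζ i) := by
        rw [integral_finsetSum _ fun i _ => (hint i).integral_prod_left.const_mul _]
        simp only [integral_const_mul]
    _ = weightedCount w (fun z => ∫ x, f x * conj (g (x + z))) ζ :=
        Finset.sum_congr rfl fun i _ => congrArg _ (integral_integral_swap (hint i))

theorem weightedCount_mul_conj_weightedCount (η : Measure (ColouredSpace d m))
    (f g : Space d → ℂ) :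
    weightedCount w f η * conj (weightedCount w g η) =
      ∑ i, (w i : ℂ) * ∫ x,
        f x * conj (weightedCount w (fun z => g (x + z)) (translate (-x) η)) ∂(colour η i) := by
  simp only [weightedCount_translate, add_neg_cancel_left, integral_mul_const]
  rw [weightedCount, Finset.sum_mul]
  simp only [mul_assoc]

theorem integrable_mul_conj_weightedCount [IsFiniteMeasure μ] (hρ : 0 < ρ)
    (hs : ∀ᵐ η ∂μ, Sparse ρ η) (f g : 𝓢(Space d, ℂ)) (i : Fin m) :
    Integrable (fun q : Space d × Measure (ColouredSpace d m) =>
      f q.1 * conj (weightedCount w (fun z => g (q.1 + z)) q.2)) (volume.prod (palm μ i)) := by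
  have := isFiniteMeasure_palm hρ hs i
  obtain ⟨C, hC⟩ := exists_norm_weightedCount_le (d := d) w hρ
  obtain ⟨B, hB⟩ := exists_norm_le_decayWeight g
  have hsparse : ∀ᵐ q ∂((volume : Measure (Space d)).prod (palm μ i)), Sparse ρ q.2 :=
    Measure.quasiMeasurePreserving_snd.ae (ae_palm_sparse hρ hs i)
  have hmeas : AEStronglyMeasurable (fun q : Space d × Measure (ColouredSpace d m) =>
      weightedCount w (fun z => g (q.1 + z)) q.2) (volume.prod (palm μ i)) :=
    aestronglyMeasurable_weightedCount w measurable_snd hsparse hρ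
      (f := fun p => g (p.1.1 + p.2)) (g.continuous.measurable.comp (by fun_prop))
  refine ((f.integrable.norm.mul_const (B * C)).comp_fst (palm μ i)).mono'
    ((f.continuous.measurable.comp measurable_fst).aestronglyMeasurable.mul
      (Complex.continuous_conj.comp_aestronglyMeasurable hmeas)) ?_
  filter_upwards [hsparse] with q hq
  rw [norm_mul, RCLike.norm_conj]
  gcongr
  refine hC _ hq _ B (-q.1) fun z => ?_
  rw [sub_neg_eq_add, add_comm z]
  exact hB _

theorem integral_weightedCount_mul_conj [IsFiniteMeasure μ] (hρ : 0 < ρ)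
    (hs : ∀ᵐ η ∂μ, Sparse ρ η) (hst : ∀ t, μ.map (translate t) = μ) (f g : 𝓢(Space d, ℂ)) :
    ∫ η, weightedCount w f η * conj (weightedCount w g η) ∂μ =
      weightedFirstMoment μ w fun z => ∫ x, f x * conj (g (x + z)) := by
  have hint := integrable_mul_conj_weightedCount w hρ hs f g
  simp only [weightedCount_mul_conj_weightedCount]
  rw [integral_finsetSum _ fun i _ =>
    (integrable_integral_campbell hρ hs hst (hint i)).const_mul _, weightedFirstMoment,
    weightedPalmIntegral]
  refine Finset.sum_congr rfl fun i _ => ?_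
  rw [integral_const_mul, integral_integral_campbell hρ hs hst (hint i)]
  refine congrArg _ (integral_congr_ae ?_)
  filter_upwards [ae_palm_sparse hρ hs i] with ζ hζ
  exact integral_mul_conj_weightedCount w hζ hρ f g

end SecondMoment

section Correlation

variable {E : Type*} [NormedAddCommGroup E] [InnerProductSpace ℝ E]

/-- The Schwartz function `x ↦ f x * conj (g x)`. -/
noncomputable def mulConj (f g : 𝓢(E, ℂ)) : 𝓢(E, ℂ) :=
  SchwartzMap.smulLeftCLM ℂ (fun x => conj (g x)) f

theorem mulConj_apply (f g : 𝓢(E, ℂ)) (x : E) : mulConj f g x = f x * conj (g x) := by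
  have hconj : (fun x => conj (g x)).HasTemperateGrowth :=
    (Complex.conjCLE.toContinuousLinearMap.hasTemperateGrowth).comp g.hasTemperateGrowth
  rw [mulConj, SchwartzMap.smulLeftCLM_apply_apply hconj, smul_eq_mul, mul_comm]

variable [FiniteDimensional ℝ E] [MeasurableSpace E] [BorelSpace E]

theorem fourier_compSubConstCLM_neg (g : 𝓢(E, ℂ)) (z y : E) :
    𝓕 (SchwartzMap.compSubConstCLM ℂ (-z) g) y =
      (Real.fourierChar (inner ℝ z y) : ℂ) * 𝓕 g y := by
  have h := congrFun (VectorFourier.fourierIntegral_comp_add_right Real.fourierChar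
    (volume : Measure E) (innerₗ E) g z) y
  rw [SchwartzMap.fourier_coe, SchwartzMap.fourier_coe,
    show (⇑(SchwartzMap.compSubConstCLM ℂ (-z) g) : E → ℂ) = g ∘ fun v => v + z by
      ext v; simp]
  exact h

theorem integral_mul_conj_comp_add (f g : 𝓢(E, ℂ)) (z : E) :
    ∫ x, f x * conj (g (x + z)) = 𝓕 (mulConj (𝓕 f) (𝓕 g)) z := by
  have h := SchwartzMap.integral_inner_fourier_fourier (SchwartzMap.compSubConstCLM ℂ (-z) g) f
  simp only [RCLike.inner_apply, SchwartzMap.compSubConstCLM_apply, sub_neg_eq_add] at h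
  rw [← h, SchwartzMap.fourier_coe (mulConj _ _), Real.fourier_eq]
  refine integral_congr_ae (Eventually.of_forall fun y => ?_)
  simp only [fourier_compSubConstCLM_neg, mulConj_apply, Circle.smul_def, smul_eq_mul, map_mul,
    AddChar.map_neg_eq_inv, Circle.coe_inv_eq_conj, real_inner_comm z y]
  ring

end Correlation

section SchwartzDensity

open scoped ContDiff

variable {E : Type*} [NormedAddCommGroup E] [InnerProductSpace ℝ E]

theorem exists_norm_pow_mul_iteratedFDeriv_smul_le {χ : E → ℝ} (hχ : ContDiff ℝ ∞ χ)
    (hc : HasCompactSupport χ) (f : 𝓢(E, ℂ)) (k n : ℕ) : ∃ C, ∀ c : ℝ, |c| ≤ 1 → ∀ x,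
      ‖x‖ ^ k * ‖iteratedFDeriv ℝ n (fun y => χ (c • y) • f y) x‖ ≤ C := by
  have hle : ∀ j : ℕ, ((j : ℕ∞) : WithTop ℕ∞) ≤ (∞ : ℕ∞ω) := fun j => mod_cast le_top
  have hbound : ∀ i : ℕ, ∃ D, ∀ x, ‖iteratedFDeriv ℝ i χ x‖ ≤ D := fun i =>
    (hc.iteratedFDeriv i).exists_bound_of_continuous (hχ.continuous_iteratedFDeriv (hle i))
  choose D hD using hbound
  have hscaled : ∀ c : ℝ, |c| ≤ 1 → ∀ i x, ‖iteratedFDeriv ℝ i (fun y => χ (c • y)) x‖ ≤ D i := by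
    intro c hc1 i x
    rw [iteratedFDeriv_comp_const_smul c (hχ.of_le (hle i)), norm_smul, norm_pow,
      Real.norm_eq_abs]
    exact (mul_le_of_le_one_left (norm_nonneg _) (pow_le_one₀ (abs_nonneg c) hc1)).trans (hD i _)
  refine ⟨∑ i ∈ Finset.range (n + 1), (n.choose i : ℝ) * D i * SchwartzMap.seminorm ℝ k (n - i) f,
    fun c hc1 x => ?_⟩
  calc ‖x‖ ^ k * ‖iteratedFDeriv ℝ n (fun y => χ (c • y) • f y) x‖
      ≤ ‖x‖ ^ k * ∑ i ∈ Finset.range (n + 1), (n.choose i : ℝ) *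
          ‖iteratedFDeriv ℝ i (fun y => χ (c • y)) x‖ * ‖iteratedFDeriv ℝ (n - i) f x‖ := by
        gcongr
        exact norm_iteratedFDeriv_smul_le (hχ.comp (contDiff_const_smul c)) (f.smooth ⊤) x (hle n)
    _ = ∑ i ∈ Finset.range (n + 1), (n.choose i : ℝ) *
          ‖iteratedFDeriv ℝ i (fun y => χ (c • y)) x‖ *
            (‖x‖ ^ k * ‖iteratedFDeriv ℝ (n - i) f x‖) := by
        rw [Finset.mul_sum]
        exact Finset.sum_congr rfl fun i _ => by ring
    _ ≤ _ := by
        refine Finset.sum_le_sum fun i _ => ?_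
        have := (norm_nonneg _).trans (hscaled c hc1 i x)
        gcongr
        · exact hscaled c hc1 i x
        · exact SchwartzMap.le_seminorm ℝ k (n - i) f x

theorem exists_norm_pow_mul_iteratedFDeriv_truncation_sub_le {χ : E → ℝ} (hχ : ContDiff ℝ ∞ χ)
    (hc : HasCompactSupport χ) (h1 : ∀ᶠ x in 𝓝ˢ (Metric.closedBall 0 1), χ x = 1)
    (f : 𝓢(E, ℂ)) (k n : ℕ) : ∃ C, ∀ R : ℝ, 1 ≤ R → ∀ x,
      ‖x‖ ^ k * ‖iteratedFDeriv ℝ n (fun y => χ (R⁻¹ • y) • f y - f y) x‖ ≤ C / R := by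
  obtain ⟨C, hC⟩ := exists_norm_pow_mul_iteratedFDeriv_smul_le hχ hc f (k + 1) n
  have hC0 : 0 ≤ C := (by positivity : (0 : ℝ) ≤ _).trans (hC 0 (by simp) 0)
  refine ⟨C + SchwartzMap.seminorm ℝ (k + 1) n f, fun R hR x => ?_⟩
  have hR0 : 0 < R := one_pos.trans_le hR
  rcases le_or_gt ‖x‖ R with hx | hx
  · have hmem : R⁻¹ • x ∈ Metric.closedBall (0 : E) 1 := by
      rw [mem_closedBall_zero_iff, norm_smul, norm_inv, Real.norm_of_nonneg hR0.le,
        inv_mul_le_iff₀ hR0, mul_one]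
      exact hx
    have hev : (fun y => χ (R⁻¹ • y) • f y - f y) =ᶠ[𝓝 x] fun _ => 0 := by
      have hcont : ContinuousAt (fun y : E => R⁻¹ • y) x := by fun_prop
      filter_upwards [hcont.eventually (h1.filter_mono (nhds_le_nhdsSet hmem))] with y hy
      rw [hy, one_smul, sub_self]
    rw [(hev.iteratedFDeriv ℝ n).eq_of_nhds, iteratedFDeriv_fun_zero, Pi.zero_apply, norm_zero,
      mul_zero]
    positivity
  · have hn : ((n : ℕ∞) : WithTop ℕ∞) ≤ (∞ : ℕ∞ω) := mod_cast le_top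
    have hR1 : |R⁻¹| ≤ 1 := by
      rw [abs_of_pos (inv_pos.2 hR0)]
      exact inv_le_one_of_one_le₀ hR
    have hsub : iteratedFDeriv ℝ n (fun y => χ (R⁻¹ • y) • f y - f y) x =
        iteratedFDeriv ℝ n (fun y => χ (R⁻¹ • y) • f y) x - iteratedFDeriv ℝ n f x :=
      iteratedFDeriv_sub_apply
        (((hχ.comp (contDiff_const_smul _)).smul (f.smooth ⊤)).of_le hn).contDiffAt
        ((f.smooth ⊤).of_le hn).contDiffAt
    rw [hsub, le_div_iff₀ hR0]
    calc ‖x‖ ^ k * ‖iteratedFDeriv ℝ n (fun y => χ (R⁻¹ • y) • f y) x -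
            iteratedFDeriv ℝ n f x‖ * R
        ≤ ‖x‖ ^ k * (‖iteratedFDeriv ℝ n (fun y => χ (R⁻¹ • y) • f y) x‖ +
            ‖iteratedFDeriv ℝ n f x‖) * ‖x‖ := by
          gcongr
          exact norm_sub_le _ _
      _ = ‖x‖ ^ (k + 1) * ‖iteratedFDeriv ℝ n (fun y => χ (R⁻¹ • y) • f y) x‖ +
            ‖x‖ ^ (k + 1) * ‖iteratedFDeriv ℝ n f x‖ := by ring
      _ ≤ _ := add_le_add (hC _ hR1 x) (SchwartzMap.le_seminorm ℝ (k + 1) n f x)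

variable [FiniteDimensional ℝ E]

theorem exists_smooth_cutoff {s U : Set E} (hs : IsCompact s) (hU : IsOpen U) (hsU : s ⊆ U) :
    ∃ χ : E → ℝ, ContDiff ℝ ∞ χ ∧ HasCompactSupport χ ∧ (∀ᶠ x in 𝓝ˢ s, χ x = 1) ∧
      (∀ x ∉ U, χ x = 0) ∧ ∀ x, 0 ≤ χ x ∧ χ x ≤ 1 := by
  obtain ⟨t, ht, hst, htU⟩ := exists_compact_between hs hU hsU
  obtain ⟨χ, h1, h0, hχ⟩ := exists_contMDiffMap_one_nhds_of_subset_interior (n := (⊤ : ℕ∞))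
    (modelWithCornersSelf ℝ E) hs.isClosed hst
  exact ⟨χ, χ.contMDiff.contDiff, HasCompactSupport.intro ht h0, h1,
    fun x hx => h0 x fun hxt => hx (htU hxt), hχ⟩

theorem dense_hasCompactSupport : Dense {f : 𝓢(E, ℂ) | HasCompactSupport f} := by
  intro f
  obtain ⟨χ, hχ, hc, h1, -, -⟩ := exists_smooth_cutoff (isCompact_closedBall (0 : E) 1)
    isOpen_univ (Set.subset_univ _)
  have hcN : ∀ N : ℕ, HasCompactSupport fun x => χ ((N + 1 : ℝ)⁻¹ • x) • f x := fun N =>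
    (hc.comp_smul (c := (N + 1 : ℝ)⁻¹) (by positivity)).smul_right
  have hsN : ∀ N : ℕ, ContDiff ℝ ∞ fun x => χ ((N + 1 : ℝ)⁻¹ • x) • f x := fun N =>
    (hχ.comp (contDiff_const_smul _)).smul (f.smooth ⊤)
  refine mem_closure_of_tendsto (b := atTop)
    (f := fun N : ℕ => (hcN N).toSchwartzMap (hsN N)) ?_ (Eventually.of_forall hcN)
  rw [(schwartz_withSeminorms ℝ E ℂ).tendsto_nhds _ f]
  rintro ⟨k, n⟩ ε hε
  obtain ⟨C, hC⟩ := exists_norm_pow_mul_iteratedFDeriv_truncation_sub_le hχ hc h1 f k n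
  have hlim : Tendsto (fun N : ℕ => C / ((N : ℝ) + 1)) atTop (𝓝 0) := by
    simpa only [mul_one_div, mul_zero] using
      (tendsto_one_div_add_atTop_nhds_zero_nat (𝕜 := ℝ)).const_mul C
  filter_upwards [hlim.eventually (gt_mem_nhds hε)] with N hN
  have hbound := hC (N + 1) (by linarith [Nat.cast_nonneg (α := ℝ) N])
  have hcoe : (⇑((hcN N).toSchwartzMap (hsN N) - f) : E → ℂ) =
      fun y => χ ((N + 1 : ℝ)⁻¹ • y) • f y - f y := rfl
  have h0 : 0 ≤ C / ((N : ℝ) + 1) := (by positivity : (0 : ℝ) ≤ _).trans (hbound 0)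
  refine (SchwartzMap.seminorm_le_bound ℝ k n _ h0 fun x => ?_).trans_lt hN
  rw [hcoe]
  exact hbound x

end SchwartzDensity

section Riesz

open scoped ContDiff CompactlySupported ComplexOrder

variable {E : Type*} [NormedAddCommGroup E] [InnerProductSpace ℝ E]

/-- A smooth compactly supported real function as a complex Schwartz function. -/
noncomputable def toComplexSchwartz (f : E → ℝ) (hf : ContDiff ℝ ∞ f) (hc : HasCompactSupport f) :
    𝓢(E, ℂ) :=
  HasCompactSupport.toSchwartzMap (f := fun x => (f x : ℂ))
    (hc.comp_left (g := fun r : ℝ => (r : ℂ)) Complex.ofReal_zero)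
    (Complex.ofRealCLM.contDiff.comp hf)

@[simp]
theorem toComplexSchwartz_apply (f : E → ℝ) (hf : ContDiff ℝ ∞ f) (hc : HasCompactSupport f)
    (x : E) : toComplexSchwartz f hf hc x = f x := rfl

variable [FiniteDimensional ℝ E]

theorem nonneg_of_nonneg_mulConj {L : 𝓢(E, ℂ) →ₗ[ℂ] ℂ} (hL : ∀ φ, 0 ≤ L (mulConj φ φ))
    {f : E → ℝ} (hf : ContDiff ℝ ∞ f) (hc : HasCompactSupport f) (h0 : ∀ x, 0 ≤ f x) :
    0 ≤ L (toComplexSchwartz f hf hc) := by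
  obtain ⟨χ, hχ, hχc, h1, -, -⟩ := exists_smooth_cutoff hc.isCompact isOpen_univ
    (Set.subset_univ (tsupport f))
  have hχf : ∀ x, χ x * χ x * f x = f x := fun x => by
    by_cases hx : x ∈ tsupport f
    · rw [h1.self_of_nhdsSet x hx, one_mul, one_mul]
    · rw [image_eq_zero_of_notMem_tsupport hx, mul_zero]
  set X := mulConj (toComplexSchwartz χ hχ hχc) (toComplexSchwartz χ hχ hχc)
  -- The root of `f` need not be smooth, but that of `f + ε` is.
  have hregularized : ∀ ε : ℝ, 0 < ε → 0 ≤ L (toComplexSchwartz f hf hc) + ε * L X := by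
    intro ε hε
    have hpos : ∀ x, 0 < f x + ε := fun x => add_pos_of_nonneg_of_pos (h0 x) hε
    have hsqrt : ContDiff ℝ ∞ fun x => χ x * √(f x + ε) :=
      hχ.mul ((hf.add contDiff_const).sqrt fun x => (hpos x).ne')
    set φ := toComplexSchwartz _ hsqrt hχc.mul_right
    have hφ : mulConj φ φ = toComplexSchwartz f hf hc + (ε : ℂ) • X := by
      ext x
      simp only [φ, X, mulConj_apply, add_apply, smul_apply, smul_eq_mul,
        toComplexSchwartz_apply, Complex.conj_ofReal]
      norm_cast
      rw [mul_mul_mul_comm, Real.mul_self_sqrt (hpos x).le, mul_add, hχf, mul_comm ε]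
    simpa only [hφ, map_add, map_smul, smul_eq_mul] using hL φ
  have hlim : Tendsto (fun ε : ℝ => L (toComplexSchwartz f hf hc) + ε * L X) (𝓝[>] 0)
      (𝓝 (L (toComplexSchwartz f hf hc))) := by
    refine ((Continuous.tendsto' (by fun_prop) 0 _ ?_).mono_left nhdsWithin_le_nhds)
    rw [Complex.ofReal_zero, zero_mul, add_zero]
  exact ge_of_tendsto hlim (eventually_mem_nhdsWithin.mono hregularized)

theorem exists_smooth_add_nonneg {f : E → ℝ} (hf : Continuous f) (hc : HasCompactSupport f) :
    ∃ g : E → ℝ, ContDiff ℝ ∞ g ∧ HasCompactSupport g ∧ (∀ x, 0 ≤ g x) ∧ ∀ x, 0 ≤ g x + f x := by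
  obtain ⟨χ, hχ, hχc, h1, -, hb⟩ := exists_smooth_cutoff hc.isCompact isOpen_univ
    (Set.subset_univ (tsupport f))
  obtain ⟨C, hC⟩ := hc.exists_bound_of_continuous hf
  have hg : ∀ x, 0 ≤ C * χ x := fun x => mul_nonneg ((norm_nonneg _).trans (hC x)) (hb x).1
  refine ⟨fun x => C * χ x, contDiff_const.mul hχ, hχc.mul_left, hg, fun x => ?_⟩
  by_cases hx : x ∈ tsupport f
  · beta_reduce
    rw [h1.self_of_nhdsSet x hx]
    linarith [(abs_le.1 (hC x)).1]
  · rw [image_eq_zero_of_notMem_tsupport hx, add_zero]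
    exact hg x

theorem im_eq_zero_of_nonneg_mulConj {L : 𝓢(E, ℂ) →ₗ[ℂ] ℂ} (hL : ∀ φ, 0 ≤ L (mulConj φ φ))
    {f : E → ℝ} (hf : ContDiff ℝ ∞ f) (hc : HasCompactSupport f) :
    (L (toComplexSchwartz f hf hc)).im = 0 := by
  obtain ⟨g, hg, hgc, hg0, hgf⟩ := exists_smooth_add_nonneg hf.continuous hc
  have hsum : toComplexSchwartz f hf hc =
      toComplexSchwartz _ (hg.add hf) (hgc.add hc) - toComplexSchwartz g hg hgc := by
    ext x
    simp
  rw [hsum, map_sub, Complex.sub_im,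
    ← (Complex.nonneg_iff.1 (nonneg_of_nonneg_mulConj hL (hg.add hf) (hgc.add hc) hgf)).2,
    ← (Complex.nonneg_iff.1 (nonneg_of_nonneg_mulConj hL hg hgc hg0)).2, sub_zero]

variable (E) in
/-- The smooth functions in `C_c(E, ℝ)`. -/
def smoothSubmodule : Submodule ℝ C_c(E, ℝ) where
  carrier := {f | ContDiff ℝ ∞ f}
  add_mem' {f g} (hf : ContDiff ℝ ∞ f) (hg : ContDiff ℝ ∞ g) :=
    show ContDiff ℝ ∞ ⇑(f + g) from hf.add hg
  zero_mem' := show ContDiff ℝ ∞ ⇑(0 : C_c(E, ℝ)) from contDiff_const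
  smul_mem' c f (hf : ContDiff ℝ ∞ f) := show ContDiff ℝ ∞ ⇑(c • f) from contDiff_const.smul hf

/-- The real part of a functional on Schwartz functions, restricted to the smooth functions in
`C_c(E, ℝ)`. -/
noncomputable def smoothFunctional (L : 𝓢(E, ℂ) →ₗ[ℂ] ℂ) : smoothSubmodule E →ₗ[ℝ] ℝ where
  toFun f := (L (toComplexSchwartz f f.2 f.1.hasCompactSupport)).re
  map_add' f g := by
    rw [← Complex.add_re, ← map_add]
    congr 2
    ext x
    exact Complex.ofReal_add _ _
  map_smul' c f := by
    rw [RingHom.id_apply, smul_eq_mul, ← Complex.re_ofReal_mul, ← smul_eq_mul, ← map_smul]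
    congr 2
    ext x
    exact Complex.ofReal_mul _ _

theorem exists_positive_extension {L : 𝓢(E, ℂ) →ₗ[ℂ] ℂ} (hL : ∀ φ, 0 ≤ L (mulConj φ φ)) :
    ∃ Λ : C_c(E, ℝ) →ₚ[ℝ] ℝ, ∀ f : smoothSubmodule E, Λ f = smoothFunctional L f := by
  let nonnegCone : PointedCone ℝ C_c(E, ℝ) :=
    { carrier := {f | ∀ x, 0 ≤ f x}
      add_mem' := fun hf hg x => add_nonneg (hf x) (hg x)
      zero_mem' := fun _ => le_rfl
      smul_mem' := fun c f hf x => mul_nonneg c.2 (hf x) }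
  have hdom : ∀ f : C_c(E, ℝ), ∃ g : smoothSubmodule E, (g : C_c(E, ℝ)) + f ∈ nonnegCone := by
    intro f
    obtain ⟨g, hg, hgc, -, hgf⟩ := exists_smooth_add_nonneg f.continuous f.hasCompactSupport
    exact ⟨⟨⟨⟨g, hg.continuous⟩, hgc⟩, hg⟩, hgf⟩
  obtain ⟨Λ, hΛ, hpos⟩ := riesz_extension nonnegCone ⟨smoothSubmodule E, smoothFunctional L⟩
    (fun f hf => (Complex.nonneg_iff.1
      (nonneg_of_nonneg_mulConj hL f.2 f.1.hasCompactSupport hf)).1) hdom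
  exact ⟨PositiveLinearMap.mk₀ Λ fun f hf => hpos f hf, hΛ⟩

variable [MeasurableSpace E] [BorelSpace E]

theorem exists_measure_of_nonneg_mulConj {L : 𝓢(E, ℂ) →ₗ[ℂ] ℂ} (hL : ∀ φ, 0 ≤ L (mulConj φ φ)) :
    ∃ ν : Measure E, IsLocallyFiniteMeasure ν ∧
      ∀ f : 𝓢(E, ℂ), HasCompactSupport f → ∫ x, f x ∂ν = L f := by
  obtain ⟨Λ, hΛ⟩ := exists_positive_extension hL
  have hreal : ∀ (f : E → ℝ) (hf : ContDiff ℝ ∞ f) (hc : HasCompactSupport f),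
      ((∫ x, f x ∂(RealRMK.rieszMeasure Λ) : ℝ) : ℂ) = L (toComplexSchwartz f hf hc) := by
    intro f hf hc
    refine Complex.ext ?_ ?_
    · exact (RealRMK.integral_rieszMeasure Λ ⟨⟨f, hf.continuous⟩, hc⟩).trans
        (hΛ ⟨⟨⟨f, hf.continuous⟩, hc⟩, hf⟩)
    · rw [Complex.ofReal_im, im_eq_zero_of_nonneg_mulConj hL]
  refine ⟨RealRMK.rieszMeasure Λ, inferInstance, fun f hc => ?_⟩
  have hre : ContDiff ℝ ∞ fun x => (f x).re := Complex.reCLM.contDiff.comp (f.smooth ⊤)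
  have him : ContDiff ℝ ∞ fun x => (f x).im := Complex.imCLM.contDiff.comp (f.smooth ⊤)
  have hcre : HasCompactSupport fun x => (f x).re := hc.comp_left Complex.zero_re
  have hcim : HasCompactSupport fun x => (f x).im := hc.comp_left Complex.zero_im
  have hdecomp : f = toComplexSchwartz _ hre hcre + Complex.I • toComplexSchwartz _ him hcim := by
    ext x
    simp only [add_apply, smul_apply, toComplexSchwartz_apply, smul_eq_mul,
      mul_comm Complex.I, Complex.re_add_im]
  have hint := integral_re_add_im (𝕜 := ℂ)
    (f.continuous.integrable_of_hasCompactSupport (μ := RealRMK.rieszMeasure Λ) hc)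
  conv_rhs => rw [hdecomp, map_add, map_smul, ← hreal, ← hreal, smul_eq_mul, mul_comm Complex.I]
  exact hint.symm

theorem measure_le_of_isCompact_of_integral_schwartz {ν ν' : Measure E} [IsLocallyFiniteMeasure ν]
    [IsLocallyFiniteMeasure ν'] (h : ∀ f : 𝓢(E, ℂ), ∫ x, f x ∂ν = ∫ x, f x ∂ν') {s : Set E}
    (hs : IsCompact s) : ν s ≤ ν' s := by
  rw [s.measure_eq_iInf_isOpen ν']
  refine le_iInf fun V => le_iInf fun hsV => le_iInf fun hV => ?_
  obtain ⟨χ, hχ, hc, h1, h0, hb⟩ := exists_smooth_cutoff hs hV hsV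
  have hlint : ∀ (P : Measure E) [IsLocallyFiniteMeasure P],
      ENNReal.ofReal (∫ x, χ x ∂P) = ∫⁻ x, ENNReal.ofReal (χ x) ∂P := fun P _ =>
    ofReal_integral_eq_lintegral_ofReal (hχ.continuous.integrable_of_hasCompactSupport hc)
      (Eventually.of_forall fun x => (hb x).1)
  have heq : ∫ x, χ x ∂ν = ∫ x, χ x ∂ν' := by
    have := h (toComplexSchwartz χ hχ hc)
    simp only [toComplexSchwartz_apply, integral_complex_ofReal] at this
    exact_mod_cast this
  calc ν s ≤ ∫⁻ x, ENNReal.ofReal (χ x) ∂ν :=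
        meas_le_lintegral₀ hχ.continuous.measurable.ennreal_ofReal.aemeasurable fun x hx => by
          rw [h1.self_of_nhdsSet x hx, ENNReal.ofReal_one]
    _ = ∫⁻ x, ENNReal.ofReal (χ x) ∂ν' := by rw [← hlint, ← hlint, heq]
    _ ≤ ν' V := lintegral_le_meas (fun x => ENNReal.ofReal_le_one.2 (hb x).2) fun x hx => by
        rw [h0 x hx, ENNReal.ofReal_zero]

theorem ext_of_integral_schwartz {ν ν' : Measure E} [IsLocallyFiniteMeasure ν]
    [IsLocallyFiniteMeasure ν'] (h : ∀ f : 𝓢(E, ℂ), ∫ x, f x ∂ν = ∫ x, f x ∂ν') : ν = ν' := by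
  refine Measure.OuterRegular.ext_isOpen fun _ =>
    (Measure.InnerRegularWRT.eq_of_innerRegularWRT_of_forall_eq Measure.Regular.innerRegular
      Measure.Regular.innerRegular fun s hs => le_antisymm ?_ ?_)
  · exact measure_le_of_isCompact_of_integral_schwartz h hs
  · exact measure_le_of_isCompact_of_integral_schwartz (fun f => (h f).symm) hs

theorem translationBounded_of_integral_le {ρ : ℝ} {ν : Measure E} [IsLocallyFiniteMeasure ν]
    {χ : E → ℝ} (hχ : Continuous χ) (hc : HasCompactSupport χ) (h0 : ∀ x, 0 ≤ χ x)
    (h1 : ∀ x ∈ Metric.ball 0 ρ, 1 ≤ χ x) {C : ℝ≥0} (hC : ∀ a, ∫ x, χ (x - a) ∂ν ≤ C) :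
    TranslationBounded ρ C ν := by
  intro a
  have hint : Integrable (fun x => χ (x - a)) ν :=
    (hχ.comp (by fun_prop)).integrable_of_hasCompactSupport
      (hc.comp_homeomorph (Homeomorph.subRight a))
  calc ν (Metric.ball a ρ) ≤ ∫⁻ x, ENNReal.ofReal (χ (x - a)) ∂ν :=
        meas_le_lintegral₀ hint.1.aemeasurable.ennreal_ofReal fun x hx =>
          ENNReal.one_le_ofReal.2 (h1 _ (mem_ball_zero_iff.2 (mem_ball_iff_norm.1 hx)))
    _ = ENNReal.ofReal (∫ x, χ (x - a) ∂ν) :=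
        (ofReal_integral_eq_lintegral_ofReal hint (Eventually.of_forall fun x => h0 _)).symm
    _ ≤ C := ENNReal.ofReal_le_of_le_toReal (hC a)

end Riesz

section FirstMoment

open scoped ComplexOrder

variable {d m : ℕ} {ρ : ℝ} {μ : Measure (Measure (ColouredSpace d m))}
  {ν : Measure (Space d)} (w : Fin m → ℝ)

theorem weightedFirstMoment_const_mul (c : ℂ) (f : Space d → ℂ) :
    weightedFirstMoment μ w (fun x => c * f x) = c * weightedFirstMoment μ w f := by
  unfold weightedFirstMoment weightedPalmIntegral
  simp only [weightedCount_const_mul, integral_const_mul, Finset.mul_sum, mul_left_comm c]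

theorem weightedFirstMoment_conj (f : Space d → ℂ) :
    weightedFirstMoment μ w (fun x => conj (f x)) = conj (weightedFirstMoment μ w f) := by
  unfold weightedFirstMoment weightedPalmIntegral
  simp only [weightedCount_conj, integral_conj, map_sum, map_mul, Complex.conj_ofReal]

variable [IsFiniteMeasure μ]

theorem exists_norm_weightedFirstMoment_le (hρ : 0 < ρ) (hs : ∀ᵐ η ∂μ, Sparse ρ η) :
    ∃ C : ℝ, ∀ (f : Space d → ℂ) (B : ℝ), (∀ x, ‖f x‖ ≤ B * decayWeight x) →
      ‖weightedFirstMoment μ w f‖ ≤ B * C := by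
  obtain ⟨C, hC⟩ := exists_norm_weightedCount_le (d := d) w hρ
  refine ⟨∑ i, |w i| * (C * (palm μ i).real Set.univ), fun f B hB => ?_⟩
  rw [weightedFirstMoment, weightedPalmIntegral, Finset.mul_sum]
  refine norm_sum_le_of_le _ fun i _ => ?_
  have := isFiniteMeasure_palm hρ hs i
  have hae : ∀ᵐ ζ ∂(palm μ i), ‖weightedCount w f ζ‖ ≤ B * C := by
    filter_upwards [ae_palm_sparse hρ hs i] with ζ hζ
    exact hC ζ hζ f B 0 (by simpa only [sub_zero] using hB)
  calc ‖(w i : ℂ) * ∫ η, weightedCount w f η ∂(palm μ i)‖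
      ≤ |w i| * (B * C * (palm μ i).real Set.univ) := by
        rw [norm_mul, Complex.norm_real, Real.norm_eq_abs]
        gcongr
        exact norm_integral_le_of_norm_le_const hae
    _ = B * (|w i| * (C * (palm μ i).real Set.univ)) := by ring

theorem weightedFirstMoment_add (hρ : 0 < ρ) (hs : ∀ᵐ η ∂μ, Sparse ρ η) (f g : 𝓢(Space d, ℂ)) :
    weightedFirstMoment μ w ⇑(f + g) = weightedFirstMoment μ w f + weightedFirstMoment μ w g := by
  unfold weightedFirstMoment weightedPalmIntegral
  rw [← Finset.sum_add_distrib]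
  refine Finset.sum_congr rfl fun i _ => ?_
  have := isFiniteMeasure_palm hρ hs i
  have hint : ∀ h : 𝓢(Space d, ℂ), Integrable (weightedCount w h) (palm μ i) := fun h =>
    (memLp_weightedCount_schwartz w (ae_palm_sparse hρ hs i) hρ h 1).integrable le_rfl
  rw [← mul_add, ← integral_add (hint f) (hint g)]
  refine congrArg _ (integral_congr_ae ?_)
  filter_upwards [ae_palm_sparse hρ hs i] with ζ hζ
  exact weightedCount_add w hζ hρ f g

theorem exists_continuousLinearMap_eq_weightedFirstMoment (hρ : 0 < ρ)
    (hs : ∀ᵐ η ∂μ, Sparse ρ η) :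
    ∃ T : 𝓢(Space d, ℂ) →L[ℂ] ℂ, ∀ f, T f = weightedFirstMoment μ w f := by
  obtain ⟨C, hC⟩ := exists_norm_weightedFirstMoment_le w hρ hs
  refine ⟨SchwartzMap.mkCLMtoNormedSpace (σ := RingHom.id ℂ) (fun f => weightedFirstMoment μ w f)
    (weightedFirstMoment_add w hρ hs) (fun c f => weightedFirstMoment_const_mul w c f) ?_,
    fun f => rfl⟩
  refine ⟨Finset.Iic (Module.finrank ℝ (Space d) + 1, 0),
    2 ^ (Module.finrank ℝ (Space d) + 1) * |C|, by positivity, fun f => ?_⟩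
  calc ‖weightedFirstMoment μ w f‖
      ≤ 2 ^ (Module.finrank ℝ (Space d) + 1) * (Finset.Iic (Module.finrank ℝ (Space d) + 1, 0)).sup
          (fun p => SchwartzMap.seminorm ℂ p.1 p.2) f * C :=
        hC f _ (norm_le_seminorm_mul_decayWeight f)
    _ ≤ 2 ^ (Module.finrank ℝ (Space d) + 1) * (Finset.Iic (Module.finrank ℝ (Space d) + 1, 0)).sup
          (fun p => SchwartzMap.seminorm ℂ p.1 p.2) f * |C| := by
        gcongr
        exact le_abs_self C
    _ = _ := mul_right_comm _ _ _

theorem weightedFirstMoment_fourier_mulConj (hρ : 0 < ρ) (hs : ∀ᵐ η ∂μ, Sparse ρ η)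
    (hst : ∀ t, μ.map (translate t) = μ) (f g : 𝓢(Space d, ℂ)) :
    weightedFirstMoment μ w (𝓕 (mulConj (𝓕 f) (𝓕 g)) : 𝓢(Space d, ℂ)) =
      ∫ η, weightedCount w f η * conj (weightedCount w g η) ∂μ := by
  rw [integral_weightedCount_mul_conj w hρ hs hst]
  exact congrArg _ (funext fun z => (integral_mul_conj_comp_add f g z).symm)

theorem weightedFirstMoment_fourier_mulConj_self_nonneg (hρ : 0 < ρ) (hs : ∀ᵐ η ∂μ, Sparse ρ η)
    (hst : ∀ t, μ.map (translate t) = μ) (φ : 𝓢(Space d, ℂ)) :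
    0 ≤ weightedFirstMoment μ w (𝓕 (mulConj φ φ) : 𝓢(Space d, ℂ)) := by
  have h := weightedFirstMoment_fourier_mulConj w hρ hs hst (𝓕⁻ φ) (𝓕⁻ φ)
  rw [FourierTransform.fourier_fourierInv_eq] at h
  rw [h]
  exact integral_nonneg fun η => mul_star_self_nonneg _

theorem exists_translationBounded (hρ : 0 < ρ) (hs : ∀ᵐ η ∂μ, Sparse ρ η)
    [IsLocallyFiniteMeasure ν]
    (hν : ∀ f : 𝓢(Space d, ℂ), HasCompactSupport f →
      ∫ x, f x ∂ν = weightedFirstMoment μ w (𝓕 f : 𝓢(Space d, ℂ))) :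
    ∃ K, TranslationBounded 1 K ν := by
  obtain ⟨χ, hχ, hc, h1, -, hb⟩ := exists_smooth_cutoff (isCompact_closedBall (0 : Space d) 1)
    isOpen_univ (Set.subset_univ _)
  obtain ⟨C, hC⟩ := exists_norm_weightedFirstMoment_le w hρ hs
  set X := toComplexSchwartz χ hχ hc
  obtain ⟨B, hB⟩ := exists_norm_le_decayWeight (𝓕 X)
  refine ⟨(B * C).toNNReal, translationBounded_of_integral_le hχ.continuous hc (fun x => (hb x).1)
    (fun x hx => (h1.self_of_nhdsSet x (Metric.ball_subset_closedBall hx)).ge) fun a => ?_⟩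
  set f := SchwartzMap.compSubConstCLM ℂ (- -a) X with hf
  have hfx : ∀ x, f x = (χ (x - a) : ℂ) := fun x => by
    rw [hf, SchwartzMap.compSubConstCLM_apply, neg_neg, toComplexSchwartz_apply]
  have hcf : HasCompactSupport f := by
    rw [show ⇑f = fun x => (χ (x - a) : ℂ) from funext hfx]
    exact (hc.comp_homeomorph (Homeomorph.subRight a)).comp_left Complex.ofReal_zero
  have hdecay : ∀ y, ‖(𝓕 f : 𝓢(Space d, ℂ)) y‖ ≤ B * decayWeight y := fun y => by
    rw [hf, fourier_compSubConstCLM_neg, norm_mul, Circle.norm_coe, one_mul]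
    exact hB y
  have hnorm := hC _ B hdecay
  simp only [← hν f hcf, hfx, integral_complex_ofReal, Complex.norm_real] at hnorm
  exact (le_abs_self _).trans (hnorm.trans (Real.le_coe_toNNReal _))

theorem exists_isFourierTransform (hρ : 0 < ρ) (hs : ∀ᵐ η ∂μ, Sparse ρ η)
    (hst : ∀ t, μ.map (translate t) = μ) :
    ∃ ν, IsFourierTransform (weightedFirstMoment μ w) ν := by
  obtain ⟨T, hT⟩ := exists_continuousLinearMap_eq_weightedFirstMoment w hρ hs
  set L : 𝓢(Space d, ℂ) →L[ℂ] ℂ := T.comp (FourierTransform.fourierCLM ℂ 𝓢(Space d, ℂ))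
  have hL : ∀ f, L f = weightedFirstMoment μ w (𝓕 f : 𝓢(Space d, ℂ)) := fun f => hT (𝓕 f)
  obtain ⟨ν, hloc, hν⟩ := exists_measure_of_nonneg_mulConj (L := L.toLinearMap) fun φ =>
    (weightedFirstMoment_fourier_mulConj_self_nonneg w hρ hs hst φ).trans_eq (hL _).symm
  obtain ⟨K, hK⟩ := exists_translationBounded w hρ hs fun f hf => (hν f hf).trans (hL f)
  have := hK.hasTemperateGrowth one_pos
  have hext := Continuous.ext_on dense_hasCompactSupport
    (SchwartzMap.integralCLM ℂ ν (D := Space d) (V := ℂ)).continuous L.continuous hν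
  exact ⟨ν, hloc, fun f => f.integrable, fun f => (congrFun hext f).trans (hL f)⟩

theorem IsFourierTransform.translationBounded (hρ : 0 < ρ) (hs : ∀ᵐ η ∂μ, Sparse ρ η)
    (hν : IsFourierTransform (weightedFirstMoment μ w) ν) : ∃ K, TranslationBounded 1 K ν :=
  have := hν.isLocallyFinite
  exists_translationBounded w hρ hs fun f _ => hν.integral_eq f

theorem IsFourierTransform.unique {ω : (Space d → ℂ) → ℂ} {ν ν' : Measure (Space d)}
    (hν : IsFourierTransform ω ν) (hν' : IsFourierTransform ω ν') : ν' = ν := by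
  have := hν.isLocallyFinite
  have := hν'.isLocallyFinite
  exact ext_of_integral_schwartz fun f => by rw [hν.integral_eq, hν'.integral_eq]

end FirstMoment

section Embedding

theorem norm_toLp_sq {α : Type*} [MeasurableSpace α] {P : Measure α} {u : α → ℂ}
    (hu : MemLp u 2 P) : (‖hu.toLp u‖ : ℂ) ^ 2 = ∫ x, u x * conj (u x) ∂P := by
  have h := inner_self_eq_norm_sq_to_K (𝕜 := ℂ) (hu.toLp u)
  rw [L2.inner_def] at h
  refine h.symm.trans (integral_congr_ae ?_)
  filter_upwards [hu.coeFn_toLp] with x hx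
  rw [hx, RCLike.inner_apply]

theorem exists_linearIsometry_of_denseRange {𝕜 V F G : Type*} [RCLike 𝕜] [AddCommGroup V]
    [Module 𝕜 V] [NormedAddCommGroup F] [NormedSpace 𝕜 F] [NormedAddCommGroup G] [NormedSpace 𝕜 G]
    [CompleteSpace G] {e : V →ₗ[𝕜] F} {T : V →ₗ[𝕜] G} (he : DenseRange e)
    (h : ∀ v, ‖T v‖ = ‖e v‖) : ∃ θ : F →ₗᵢ[𝕜] G, ∀ v, θ (e v) = T v := by
  set Θ := T.extendOfNorm e
  have hΘ : ∀ v, Θ (e v) = T v :=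
    LinearMap.extendOfNorm_eq he ⟨1, fun v => by rw [h, one_mul]⟩
  have hnorm : ∀ u, ‖Θ u‖ = ‖u‖ := fun u =>
    he.induction (P := fun u => ‖Θ u‖ = ‖u‖) (by rintro _ ⟨v, rfl⟩; rw [hΘ, h])
      (isClosed_eq (by fun_prop) (by fun_prop)) u
  exact ⟨⟨Θ.toLinearMap, hnorm⟩, hΘ⟩

variable {d m : ℕ} {ρ : ℝ} {μ : Measure (Measure (ColouredSpace d m))} (w : Fin m → ℝ)

/-- The map `f ↦ N^w_f` from Schwartz functions to `L²(μ)`. -/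
noncomputable def countLp [IsFiniteMeasure μ] (hρ : 0 < ρ) (hs : ∀ᵐ η ∂μ, Sparse ρ η) :
    𝓢(Space d, ℂ) →ₗ[ℂ] Lp ℂ 2 μ where
  toFun f := (memLp_weightedCount_schwartz w hs hρ f 2).toLp _
  map_add' f g := by
    rw [← MemLp.toLp_add]
    apply MemLp.toLp_congr
    filter_upwards [hs] with η hη
    exact weightedCount_add w hη hρ f g
  map_smul' c f := by
    rw [RingHom.id_apply, ← MemLp.toLp_const_smul]
    apply MemLp.toLp_congr
    exact Eventually.of_forall fun η => weightedCount_const_mul w η c f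

/-- The map `f ↦ f̂` from Schwartz functions to `L²(ν)`. -/
noncomputable def fourierLp (ν : Measure (Space d)) [ν.HasTemperateGrowth] :
    𝓢(Space d, ℂ) →ₗ[ℂ] Lp ℂ 2 ν :=
  (SchwartzMap.toLpCLM ℂ ℂ 2 ν).toLinearMap ∘ₗ FourierTransform.fourierₗ ℂ 𝓢(Space d, ℂ)

variable {ν : Measure (Space d)} [ν.HasTemperateGrowth]

theorem fourierLp_apply (f : 𝓢(Space d, ℂ)) :
    fourierLp ν f = ((𝓕 f).memLp 2 ν).toLp (𝓕 f : 𝓢(Space d, ℂ)) := rfl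

theorem denseRange_fourierLp [IsLocallyFiniteMeasure ν] : DenseRange (fourierLp ν) := by
  have hdense : DenseRange (SchwartzMap.toLpCLM ℝ ℂ 2 ν : 𝓢(Space d, ℂ) → Lp ℂ 2 ν) :=
    SchwartzMap.denseRange_toLpCLM (by norm_num)
  have hsurj : Function.Surjective (FourierTransform.fourierₗ ℂ 𝓢(Space d, ℂ)) := fun f =>
    ⟨𝓕⁻ f, by simp⟩
  rw [DenseRange, fourierLp, LinearMap.coe_comp, hsurj.range_comp]
  exact hdense

variable [IsFiniteMeasure μ]

theorem isDiffractionEmbedding_iff (hρ : 0 < ρ) (hs : ∀ᵐ η ∂μ, Sparse ρ η)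
    (θ : Lp ℂ 2 ν →ₗᵢ[ℂ] Lp ℂ 2 μ) :
    IsDiffractionEmbedding μ w ν θ ↔
      ∀ f : 𝓢(Space d, ℂ), θ (fourierLp ν f) = countLp w hρ hs f := by
  refine forall_congr' fun f => ⟨fun ⟨_, h⟩ => Lp.ext (h.trans ?_), fun h => ⟨(𝓕 f).memLp 2 ν, ?_⟩⟩
  · exact (memLp_weightedCount_schwartz w hs hρ f 2).coeFn_toLp.symm
  · rw [← fourierLp_apply, h]
    exact (memLp_weightedCount_schwartz w hs hρ f 2).coeFn_toLp

theorem IsFourierTransform.norm_countLp (hρ : 0 < ρ) (hs : ∀ᵐ η ∂μ, Sparse ρ η)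
    (hst : ∀ t, μ.map (translate t) = μ) (hν : IsFourierTransform (weightedFirstMoment μ w) ν)
    (f : 𝓢(Space d, ℂ)) : ‖countLp w hρ hs f‖ = ‖fourierLp ν f‖ := by
  refine (pow_left_inj₀ (norm_nonneg _) (norm_nonneg _) two_ne_zero).1 ?_
  have h : (‖countLp w hρ hs f‖ : ℂ) ^ 2 = (‖fourierLp ν f‖ : ℂ) ^ 2 :=
    calc (‖countLp w hρ hs f‖ : ℂ) ^ 2
        = ∫ η, weightedCount w f η * conj (weightedCount w f η) ∂μ :=
          norm_toLp_sq (memLp_weightedCount_schwartz w hs hρ f 2)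
      _ = weightedFirstMoment μ w (𝓕 (mulConj (𝓕 f) (𝓕 f)) : 𝓢(Space d, ℂ)) :=
          (weightedFirstMoment_fourier_mulConj w hρ hs hst f f).symm
      _ = ∫ y, (𝓕 f : 𝓢(Space d, ℂ)) y * conj ((𝓕 f : 𝓢(Space d, ℂ)) y) ∂ν := by
          simp only [← hν.integral_eq, mulConj_apply]
      _ = (‖fourierLp ν f‖ : ℂ) ^ 2 := (norm_toLp_sq ((𝓕 f).memLp 2 ν)).symm
  exact_mod_cast h

theorem IsFourierTransform.existsUnique_embedding (hρ : 0 < ρ) (hs : ∀ᵐ η ∂μ, Sparse ρ η)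
    (hst : ∀ t, μ.map (translate t) = μ) (hν : IsFourierTransform (weightedFirstMoment μ w) ν) :
    ∃ θ : Lp ℂ 2 ν →ₗᵢ[ℂ] Lp ℂ 2 μ, IsDiffractionEmbedding μ w ν θ ∧
      ∀ θ' : Lp ℂ 2 ν →ₗᵢ[ℂ] Lp ℂ 2 μ, IsDiffractionEmbedding μ w ν θ' → θ' = θ := by
  have := hν.isLocallyFinite
  obtain ⟨θ, hθ⟩ := exists_linearIsometry_of_denseRange denseRange_fourierLp
    (hν.norm_countLp w hρ hs hst)
  simp only [isDiffractionEmbedding_iff w hρ hs]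
  refine ⟨θ, hθ, fun θ' hθ' => LinearIsometry.ext (congrFun ?_)⟩
  exact denseRange_fourierLp.equalizer θ'.continuous θ.continuous
    (funext fun f => (hθ' f).trans (hθ f).symm)

end Embedding

section PointMasses

variable {d m : ℕ} {r : ℝ} {η : Measure (ColouredSpace d m)}

theorem exists_finset_of_mem_pointMeasures (hr : 0 < r) (hη : η ∈ pointMeasures d m r)
    {s : Set (Space d)} (hs : MeasurableSet s) (hb : Bornology.IsBounded s) :
    ∃ F : Finset (Space d), ∀ᵐ p ∂η, p.1 ∈ s → p.1 ∈ F := by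
  classical
  have hs' : MeasurableSet (Prod.fst ⁻¹' s : Set (ColouredSpace d m)) := measurable_fst hs
  have hmass : η (Prod.fst ⁻¹' s) ≠ ∞ := by
    obtain ⟨R, hR⟩ := hb.subset_ball 0
    obtain ⟨C, hC⟩ := exists_measure_ball_le (Space d) (half_pos hr) 1 R
    rw [← Measure.map_apply measurable_fst hs]
    exact ne_top_of_le_ne_top ENNReal.coe_ne_top
      ((measure_mono hR).trans (hC _ (Sparse.of_mem_pointMeasures hη)))
  obtain ⟨Λ, -, rfl⟩ := hη
  simp only [Measure.sum_apply _ hs', Measure.dirac_apply' _ hs'] at hmass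
  have hfin := ENNReal.finite_const_le_of_tsum_ne_top hmass one_ne_zero
  refine ⟨hfin.toFinset.image fun p : Λ => (p : ColouredSpace d m).1, ?_⟩
  have hset : MeasurableSet {p : ColouredSpace d m |
      p.1 ∈ s → p.1 ∈ hfin.toFinset.image fun p : Λ => (p : ColouredSpace d m).1} :=
    measurable_fst (hs.imp (Finset.measurableSet _))
  refine (Measure.ae_sum_iff' hset).2 fun p => (ae_dirac_iff hset).2 fun hp =>
    Finset.mem_image.2 ⟨p, hfin.mem_toFinset.2 ?_, rfl⟩
  exact (Set.indicator_of_mem (s := Prod.fst ⁻¹' s) hp (1 : ColouredSpace d m → ℝ≥0∞)).ge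

theorem ae_colour_of_ae {p : Space d → Prop} (hp : MeasurableSet {x | p x})
    (h : ∀ᵐ q ∂η, p q.1) (i : Fin m) : ∀ᵐ x ∂colour η i, p x :=
  (ae_map_iff measurable_fst.aemeasurable hp).2 (ae_restrict_of_ae h)

variable (w : Fin m → ℝ)

theorem weightedMass_eq_zero {x : Space d} (h : ∀ i, ∀ᵐ y ∂colour η i, y ≠ x) :
    weightedMass w η x = 0 :=
  Finset.sum_eq_zero fun i _ => by
    have hx : colour η i {x} = 0 := measure_eq_zero_iff_ae_notMem.2 (h i)
    rw [Measure.real, hx, ENNReal.toReal_zero, mul_zero]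

theorem weightedCount_eq_sum [∀ i, IsLocallyFiniteMeasure (colour η i)] {F : Finset (Space d)}
    {g : Space d → ℂ} (h : ∀ i, ∀ᵐ x ∂colour η i, x ∉ F → g x = 0) :
    weightedCount w g η = ∑ x ∈ F, (weightedMass w η x : ℂ) * g x := by
  have hint : ∀ i, ∫ x, g x ∂colour η i = ∑ x ∈ F, ((colour η i).real {x} : ℂ) * g x := fun i => by
    have hfin : IsFiniteMeasure ((colour η i).restrict F) :=
      ⟨by simpa using F.finite_toSet.isCompact.measure_lt_top⟩
    rw [← setIntegral_eq_integral_of_ae_compl_eq_zero (s := (F : Set (Space d))) (h i),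
      setIntegral_finset]
    · simp only [Complex.real_smul]
    · rw [← Set.inter_self (F : Set (Space d)), IntegrableOn,
        ← Measure.restrict_restrict F.measurableSet]
      exact IntegrableOn.finset
  simp only [weightedCount, weightedMass, hint, Complex.ofReal_sum, Complex.ofReal_mul,
    Finset.mul_sum, Finset.sum_mul, mul_assoc]
  exact Finset.sum_comm

end PointMasses

section Average

variable {d m : ℕ} {r R : ℝ} (w : Fin m → ℝ) (k : Space d)

/-- The dilate `x ↦ R^{-d} g(x/R)` of `g`, modulated by the character `χ_k`. For the indicator
function `g` of `C_1` its weighted count is the average over `C_R`. -/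
noncomputable def modulatedDilate (k : Space d) (g : Space d → ℂ) (R : ℝ) (x : Space d) : ℂ :=
  ((R ^ d)⁻¹ : ℝ) * g (R⁻¹ • x) * character k x

theorem measurable_modulatedDilate {g : Space d → ℂ} (hg : Measurable g) (R : ℝ) :
    Measurable (modulatedDilate k g R) :=
  ((hg.comp (measurable_const_smul R⁻¹)).const_mul _).mul (continuous_character k).measurable

theorem norm_modulatedDilate (hR : 0 < R) (g : Space d → ℂ) (x : Space d) :
    ‖modulatedDilate k g R x‖ = (R ^ d)⁻¹ * ‖g (R⁻¹ • x)‖ := by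
  rw [modulatedDilate, norm_mul, norm_mul, norm_character, mul_one, Complex.norm_real,
    Real.norm_of_nonneg (by positivity)]

theorem inv_smul_mem_cube (hR : 0 < R) (x : Space d) : R⁻¹ • x ∈ cube d 1 ↔ x ∈ cube d R := by
  refine forall_congr' fun j => ?_
  rw [PiLp.smul_apply, smul_eq_mul, abs_mul, abs_of_pos (inv_pos.2 hR), inv_mul_lt_iff₀ hR,
    mul_one_div]

theorem average_eq_weightedCount (hr : 0 < r) (hR : 0 < R) {η : Measure (ColouredSpace d m)}
    (hη : η ∈ pointMeasures d m r) :
    average w k R η = weightedCount w (modulatedDilate k ((cube d 1).indicator 1) R) η := by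
  classical
  have hloc := fun i => ((Sparse.of_mem_pointMeasures hη).colour i).isLocallyFiniteMeasure
    (half_pos hr)
  obtain ⟨F, hF⟩ := exists_finset_of_mem_pointMeasures hr hη (measurableSet_cube R)
    (isBounded_cube R)
  have hcolour : ∀ i, ∀ᵐ x ∂colour η i, x ∈ cube d R → x ∈ F :=
    ae_colour_of_ae ((measurableSet_cube R).imp F.measurableSet) hF
  have happly : ∀ x, modulatedDilate k ((cube d 1).indicator 1) R x =
      ((R ^ d : ℝ) : ℂ)⁻¹ * (cube d R).indicator (character k) x := fun x => by
    simp only [modulatedDilate, Set.indicator_apply, inv_smul_mem_cube hR, Pi.one_apply]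
    split_ifs <;> simp
  have hvol : volume.real (cube d R) = R ^ d := by
    rw [Measure.real, volume_cube, ENNReal.toReal_pow, ENNReal.toReal_ofReal hR.le]
  rw [average, hvol, tsum_subtype (cube d R) fun x => (weightedMass w η x : ℂ) * character k x,
    tsum_eq_sum (s := F), weightedCount_eq_sum w (F := F), Finset.mul_sum]
  · refine Finset.sum_congr rfl fun x _ => ?_
    rw [happly, Set.indicator_mul_right, mul_left_comm]
  · intro i
    filter_upwards [hcolour i] with x hx hxF
    rw [happly, Set.indicator_of_notMem fun h => hxF (hx h), mul_zero]
  · refine fun x hxF => Set.indicator_apply_eq_zero.2 fun hx => ?_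
    rw [weightedMass_eq_zero, Complex.ofReal_zero, zero_mul]
    intro i
    filter_upwards [hcolour i] with y hy hyx
    exact hxF (hyx ▸ hy (hyx ▸ hx))

theorem exists_norm_le_decayWeight_of_isBounded {E : Type*} [NormedAddCommGroup E]
    [InnerProductSpace ℝ E] {g : E → ℂ} {C : ℝ} (hC : ∀ x, ‖g x‖ ≤ C) {s : Set E}
    (hs : Bornology.IsBounded s) (h0 : ∀ x ∉ s, g x = 0) :
    ∃ B, ∀ x, ‖g x‖ ≤ B * decayWeight x := by
  obtain ⟨ρ, hρ⟩ := hs.subset_ball 0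
  have hC0 : 0 ≤ C := (norm_nonneg _).trans (hC 0)
  refine ⟨C * (1 + |ρ|) ^ (Module.finrank ℝ E + 1 : ℝ), fun x => ?_⟩
  by_cases hx : x ∈ s
  · have hdist : dist 0 x < |ρ| := by
      rw [dist_comm]; exact (Metric.mem_ball.1 (hρ hx)).trans_le (le_abs_self ρ)
    have h1 := decayWeight_le_of_dist_lt hdist
    rw [decayWeight, norm_zero, add_zero, Real.one_rpow] at h1
    rw [mul_assoc]
    exact (hC x).trans (le_mul_of_one_le_right hC0 h1)
  · have := decayWeight_pos x
    rw [h0 x hx, norm_zero]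
    positivity

theorem exists_norm_modulatedDilate_cube_le (hR : 0 < R) :
    ∃ B, ∀ x, ‖modulatedDilate k ((cube d 1).indicator 1) R x‖ ≤ B * decayWeight x := by
  refine exists_norm_le_decayWeight_of_isBounded (C := (R ^ d)⁻¹) (fun x => ?_) (isBounded_cube R)
    fun x hx => ?_
  · rw [norm_modulatedDilate k hR]
    refine mul_le_of_le_one_right (by positivity) ?_
    exact (norm_indicator_le_norm_self _ _).trans_eq norm_one
  · rw [modulatedDilate, Set.indicator_of_notMem fun h => hx ((inv_smul_mem_cube hR x).1 h),
      mul_zero, zero_mul]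

variable {μ : Measure (Measure (ColouredSpace d m))} [IsFiniteMeasure μ]

theorem memLp_average (hr : 0 < r) (hμ : ∀ᵐ η ∂μ, η ∈ pointMeasures d m r) (hR : 0 < R)
    (p : ℝ≥0∞) : MemLp (average w k R) p μ := by
  obtain ⟨B, hB⟩ := exists_norm_modulatedDilate_cube_le k hR
  have h := memLp_weightedCount w (hμ.mono fun η hη => Sparse.of_mem_pointMeasures hη)
    (half_pos hr) (measurable_modulatedDilate k
      (measurable_one.indicator (measurableSet_cube 1)) R) (b := 0) (by simpa using hB) p
  refine h.ae_eq ?_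
  filter_upwards [hμ] with η hη
  exact (average_eq_weightedCount w k hr hR hη).symm

theorem exists_schwartz_eq_modulatedDilate (g : 𝓢(Space d, ℂ)) (hR : 0 < R) :
    ∃ f : 𝓢(Space d, ℂ), (f : Space d → ℂ) = modulatedDilate k g R ∧
      ∀ y, 𝓕 f y = 𝓕 g (R • (y - k)) := by
  let dilation : Space d ≃L[ℝ] Space d := ContinuousLinearEquiv.smulLeft (Units.mk0 R hR.ne')
  let h : 𝓢(Space d, ℂ) := SchwartzMap.compSubConstCLM ℂ k
    (SchwartzMap.compCLMOfContinuousLinearEquiv ℂ dilation (𝓕 g))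
  have hh : ∀ y, h y = 𝓕 g (R • (y - k)) := fun _ => rfl
  refine ⟨𝓕⁻ h, funext fun x => ?_, fun y => by rw [FourierTransform.fourier_fourierInv_eq, hh]⟩
  have hchar : ∀ y : Space d, Real.fourierChar (inner ℝ (y + k) x) • 𝓕 g (R • y) =
      character k x * (Real.fourierChar (inner ℝ (R • y) (R⁻¹ • x)) • 𝓕 g (R • y)) := fun y => by
    rw [inner_add_left, AddChar.map_add_eq_mul, real_inner_smul_left, real_inner_smul_right,
      mul_inv_cancel_left₀ hR.ne', mul_comm, mul_smul, Circle.smul_def, Real.fourierChar_apply,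
      character, smul_eq_mul]
    push_cast
    ring_nf
  rw [SchwartzMap.fourierInv_coe, Real.fourierInv_eq, ← integral_add_right_eq_self _ k]
  simp only [hh, add_sub_cancel_right, hchar]
  rw [integral_const_mul, Measure.integral_comp_smul_of_nonneg volume
    (fun y => Real.fourierChar (inner ℝ y (R⁻¹ • x)) • 𝓕 g y) R (hR := hR.le)]
  have hinv : 𝓕⁻ (𝓕 g) (R⁻¹ • x) = g (R⁻¹ • x) := by rw [FourierTransform.fourierInv_fourier_eq]
  rw [SchwartzMap.fourierInv_coe, Real.fourierInv_eq] at hinv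
  rw [hinv, finrank_euclideanSpace, Fintype.card_fin, modulatedDilate, Complex.real_smul]
  ring

end Average

section Dilation

variable {E : Type*} [NormedAddCommGroup E] [InnerProductSpace ℝ E] (k : E)

theorem decayWeight_le_one (x : E) : decayWeight x ≤ 1 :=
  Real.rpow_le_one_of_one_le_of_nonpos (by linarith [norm_nonneg x]) (by linarith)

theorem decayWeight_smul_le {R : ℝ} (hR : 1 ≤ R) (x : E) : decayWeight (R • x) ≤ decayWeight x := by
  unfold decayWeight
  refine Real.rpow_le_rpow_of_nonpos (by positivity) ?_ (by linarith)
  rw [norm_smul, Real.norm_of_nonneg (by linarith)]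
  nlinarith [norm_nonneg x]

theorem exists_norm_dilation_sub_le (h : 𝓢(E, ℂ)) : ∃ B, ∀ R : ℝ, 1 ≤ R → ∀ y,
    ‖h (R • (y - k)) - h 0 * Set.indicator {k} 1 y‖ ≤ B * decayWeight (y - k) := by
  classical
  obtain ⟨B, hB⟩ := exists_norm_le_decayWeight h
  have hB0 : 0 ≤ B := nonneg_of_mul_nonneg_left ((norm_nonneg _).trans (hB 0)) (decayWeight_pos _)
  refine ⟨B, fun R hR y => ?_⟩
  by_cases hy : y = k
  · have hzero : h (R • (y - k)) - h 0 * Set.indicator {k} 1 y = 0 := by simp [hy]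
    rw [hzero, norm_zero]
    exact mul_nonneg hB0 (decayWeight_pos _).le
  · rw [Set.indicator_of_notMem (show y ∉ ({k} : Set E) from hy), mul_zero, sub_zero]
    exact (hB _).trans (mul_le_mul_of_nonneg_left (decayWeight_smul_le hR _) hB0)

variable [FiniteDimensional ℝ E]

theorem tendsto_dilation_sub (h : 𝓢(E, ℂ)) (y : E) :
    Tendsto (fun R : ℝ => h (R • (y - k)) - h 0 * Set.indicator {k} 1 y) atTop (𝓝 0) := by
  classical
  by_cases hy : y = k
  · simp [hy]
  · simp only [Set.indicator_of_notMem (show y ∉ ({k} : Set E) from hy), mul_zero, sub_zero]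
    refine h.tendsto_cocompact.comp ?_
    rw [← Metric.cobounded_eq_cocompact, ← tendsto_norm_atTop_iff_cobounded]
    simp_rw [norm_smul]
    exact tendsto_norm_atTop_atTop.atTop_mul_const (norm_pos_iff.2 (sub_ne_zero.2 hy))

variable [MeasurableSpace E] [BorelSpace E] {ρ : ℝ} {K : ℝ≥0} {ν : Measure E}

theorem TranslationBounded.tendsto_eLpNorm_dilation_sub (hν : TranslationBounded ρ K ν)
    (hρ : 0 < ρ) (h : 𝓢(E, ℂ)) :
    Tendsto (fun R : ℝ => eLpNorm (fun y => h (R • (y - k)) - h 0 * Set.indicator {k} 1 y) 2 ν)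
      atTop (𝓝 0) := by
  obtain ⟨B, hB⟩ := exists_norm_dilation_sub_le k h
  have hlim : Tendsto (fun R : ℝ => ∫⁻ y, ‖h (R • (y - k)) - h 0 * Set.indicator {k} 1 y‖ₑ ^ (2 : ℝ)
      ∂ν) atTop (𝓝 (∫⁻ _, 0 ∂ν)) := by
    refine tendsto_lintegral_filter_of_dominated_convergence
      (fun y => ENNReal.ofReal (B ^ 2 * decayWeight (y - k))) ?_ ?_ ?_ ?_
    · have hind : Measurable (Set.indicator {k} (1 : E → ℂ)) :=
        measurable_one.indicator (measurableSet_singleton k)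
      have hdil : ∀ R : ℝ, Measurable fun y : E => h (R • (y - k)) := fun R =>
        (h.continuous.comp (by fun_prop)).measurable
      exact Eventually.of_forall fun R => ((hdil R).sub (hind.const_mul _)).enorm.pow_const _
    · filter_upwards [eventually_ge_atTop 1] with R hR
      refine Eventually.of_forall fun y => ?_
      rw [← ofReal_norm, ENNReal.ofReal_rpow_of_nonneg (norm_nonneg _) zero_le_two, Real.rpow_two]
      refine ENNReal.ofReal_le_ofReal ((pow_le_pow_left₀ (norm_nonneg _) (hB R hR y) 2).trans ?_)
      rw [mul_pow]
      gcongr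
      exact pow_le_of_le_one (decayWeight_pos _).le (decayWeight_le_one _) two_ne_zero
    · exact ((hν.integrable_decayWeight hρ k).const_mul _).lintegral_lt_top.ne
    · refine Eventually.of_forall fun y => ?_
      simpa using (tendsto_dilation_sub k h y).enorm.ennrpow_const 2
  rw [lintegral_zero] at hlim
  simpa [eLpNorm_eq_lintegral_rpow_enorm_toReal] using hlim.ennrpow_const (1 / 2)

theorem TranslationBounded.measure_preimage_inv_smul_le (hν : TranslationBounded ρ K ν)
    (hρ : 0 < ρ) {R : ℝ} (hR : 0 < R) {s : Set E} (hs : MeasurableSet s) :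
    ν ((R⁻¹ • ·) ⁻¹' s) ≤ ENNReal.ofReal (R ^ Module.finrank ℝ E) *
      (K / volume (Metric.ball (0 : E) ρ) * volume (Metric.thickening (ρ / R) s)) := by
  have hsub : Metric.thickening ρ ((R⁻¹ • ·) ⁻¹' s) ⊆ (R⁻¹ • ·) ⁻¹' Metric.thickening (ρ / R) s :=
    fun x hx => by
      obtain ⟨z, hz, hxz⟩ := Metric.mem_thickening_iff.1 hx
      refine Metric.mem_thickening_iff.2 ⟨R⁻¹ • z, hz, ?_⟩
      rw [dist_smul₀, Real.norm_of_nonneg (by positivity), div_eq_inv_mul]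
      gcongr
  calc ν ((R⁻¹ • ·) ⁻¹' s)
      ≤ K / volume (Metric.ball (0 : E) ρ) * volume (Metric.thickening ρ ((R⁻¹ • ·) ⁻¹' s)) :=
        hν.measure_le hρ (measurable_const_smul R⁻¹ hs)
    _ ≤ K / volume (Metric.ball (0 : E) ρ) *
          volume ((R⁻¹ • ·) ⁻¹' Metric.thickening (ρ / R) s) := by gcongr
    _ = _ := by
        rw [Measure.addHaar_preimage_smul volume (inv_ne_zero hR.ne'), inv_pow, inv_inv,
          abs_of_pos (by positivity), mul_left_comm]

end Dilation

section Approximation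

open scoped ContDiff

theorem enorm_integral_sub_le {α : Type*} [MeasurableSpace α] {ν : Measure α} {f g : α → ℂ}
    (hf : Integrable f ν) (hg : Integrable g ν) {s : Set α} (hs : MeasurableSet s) {c : ℝ≥0∞}
    (h : ∀ x, ‖f x - g x‖ₑ ≤ s.indicator (fun _ => c) x) :
    ‖∫ x, f x ∂ν - ∫ x, g x ∂ν‖ₑ ≤ c * ν s := by
  rw [← integral_sub hf hg, ← lintegral_indicator_const hs]
  exact (enorm_integral_le_lintegral_enorm _).trans (lintegral_mono h)

variable {E : Type*} [NormedAddCommGroup E] [InnerProductSpace ℝ E] [FiniteDimensional ℝ E]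
  [MeasurableSpace E] [BorelSpace E] {Ω : Set E}

theorem exists_volume_thickening_frontier_le (hb : Bornology.IsBounded Ω)
    (h0 : volume (frontier Ω) = 0) {δ : ℝ≥0∞} (hδ : 0 < δ) :
    ∃ s > 0, volume (Metric.thickening s (frontier Ω)) ≤ δ := by
  have hlim := tendsto_measure_thickening_of_isClosed (μ := volume)
    ⟨1, one_pos, (Bornology.IsBounded.thickening
      (hb.closure.subset frontier_subset_closure)).measure_lt_top.ne⟩ (isClosed_frontier (s := Ω))
  rw [h0] at hlim
  obtain ⟨s, hs, hpos⟩ := ((ENNReal.tendsto_nhds_zero.1 hlim δ hδ).and self_mem_nhdsWithin).exists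
  exact ⟨s, hpos, hs⟩

theorem exists_schwartz_near_indicator (hΩ : IsOpen Ω) (hb : Bornology.IsBounded Ω)
    (h0 : volume (frontier Ω) = 0) {δ : ℝ≥0∞} (hδ : 0 < δ) :
    ∃ φ : 𝓢(E, ℂ), ∃ S : Set E, MeasurableSet S ∧
      (∀ x, ‖Ω.indicator 1 x - φ x‖ₑ ≤ S.indicator 1 x) ∧
      ∃ s > 0, volume (Metric.thickening s S) ≤ δ := by
  obtain ⟨s, hs, hsδ⟩ := exists_volume_thickening_frontier_le hb h0 hδ
  set S := Metric.thickening (s / 2) (frontier Ω)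
  have hcompact : IsCompact (closure Ω \ S) := hb.isCompact_closure.diff Metric.isOpen_thickening
  have hsub : closure Ω \ S ⊆ Ω := fun x hx => by
    by_contra hxΩ
    exact hx.2 (Metric.self_subset_thickening (half_pos hs) _
      ⟨hx.1, fun h => hxΩ (hΩ.interior_eq ▸ h)⟩)
  obtain ⟨χ, hχ, hc, h1, hout, hχ01⟩ := exists_smooth_cutoff hcompact hΩ hsub
  refine ⟨toComplexSchwartz χ hχ hc, S, Metric.isOpen_thickening.measurableSet, fun x => ?_,
    s / 2, half_pos hs, (measure_mono ?_).trans hsδ⟩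
  · rw [toComplexSchwartz_apply]
    by_cases hx : x ∈ Ω
    · by_cases hxS : x ∈ S
      · rw [Set.indicator_of_mem hx, Set.indicator_of_mem hxS, Pi.one_apply, Pi.one_apply,
          ← Complex.ofReal_one, ← Complex.ofReal_sub, ← ofReal_norm, Complex.norm_real,
          Real.norm_of_nonneg (sub_nonneg.2 (hχ01 x).2), ENNReal.ofReal_le_one]
        linarith [(hχ01 x).1]
      · simp [hx, hxS, h1.self_of_nhdsSet x ⟨subset_closure hx, hxS⟩]
    · simp [hx, hout x hx]
  · exact (Metric.thickening_thickening_subset _ _ _).trans_eq (by rw [add_halves])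

theorem enorm_fourier_zero_sub_le {φ : 𝓢(E, ℂ)} (hΩ : MeasurableSet Ω)
    (hb : Bornology.IsBounded Ω) {S : Set E} (hS : MeasurableSet S)
    (h : ∀ x, ‖Ω.indicator 1 x - φ x‖ₑ ≤ S.indicator 1 x) :
    ‖𝓕 φ 0 - volume.real Ω‖ₑ ≤ volume S := by
  have hF : 𝓕 φ 0 = ∫ x, φ x := by
    simp only [SchwartzMap.fourier_coe, Real.fourier_eq, inner_zero_right, neg_zero,
      AddChar.map_zero_eq_one, one_smul]
  have hvol : ((volume.real Ω : ℝ) : ℂ) = ∫ x, Ω.indicator 1 x := by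
    rw [integral_indicator hΩ]
    simp
  have hint : Integrable (Ω.indicator (1 : E → ℂ)) :=
    (integrable_indicator_iff hΩ).2 (integrableOn_const hb.measure_lt_top.ne (C := (1 : ℂ)))
  rw [hF, hvol, ← edist_eq_enorm_sub, edist_comm, edist_eq_enorm_sub]
  simpa using enorm_integral_sub_le hint φ.integrable hS h

end Approximation

section Cube

variable {d m : ℕ} {ρ r R : ℝ} (w : Fin m → ℝ) (k : Space d)

theorem volume_frontier_cube (d : ℕ) (R : ℝ) : volume (frontier (cube d R)) = 0 := by
  have hcube : cube d R = ⋂ j, (EuclideanSpace.proj (𝕜 := ℝ) j).toLinearMap ⁻¹'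
      Metric.ball 0 (R / 2) := by
    ext x
    simp [cube]
  rw [hcube]
  exact (convex_iInter fun j => (convex_ball 0 (R / 2)).linear_preimage _).addHaar_frontier volume

theorem exists_schwartz_near_cube (d : ℕ) {δ : ℝ≥0∞} (hδ : 0 < δ) :
    ∃ φ : 𝓢(Space d, ℂ), ‖𝓕 φ 0 - 1‖ₑ ≤ δ ∧ ∃ S, MeasurableSet S ∧
      (∀ x, ‖(cube d 1).indicator 1 x - φ x‖ₑ ≤ S.indicator 1 x) ∧
      ∃ s > 0, volume (Metric.thickening s S) ≤ δ := by
  obtain ⟨φ, S, hS, h, s, hs, hδ⟩ := exists_schwartz_near_indicator (isOpen_cube 1)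
    (isBounded_cube 1) (volume_frontier_cube d 1) hδ
  refine ⟨φ, ?_, S, hS, h, s, hs, hδ⟩
  have hvol : volume.real (cube d 1) = 1 := by
    rw [Measure.real, volume_cube, ENNReal.ofReal_one, one_pow, ENNReal.toReal_one]
  have h0 := enorm_fourier_zero_sub_le (measurableSet_cube 1) (isBounded_cube 1) hS h
  rw [hvol, Complex.ofReal_one] at h0
  exact h0.trans ((measure_mono (Metric.self_subset_thickening hs S)).trans hδ)

theorem enorm_modulatedDilate_sub (hR : 0 < R) (g h : Space d → ℂ) (x : Space d) :
    ‖modulatedDilate k g R x - modulatedDilate k h R x‖ₑ =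
      (ENNReal.ofReal (R ^ d))⁻¹ * ‖g (R⁻¹ • x) - h (R⁻¹ • x)‖ₑ := by
  have hsub : modulatedDilate k g R x - modulatedDilate k h R x =
      modulatedDilate k (g - h) R x := by
    simp only [modulatedDilate, Pi.sub_apply]
    ring
  rw [hsub, ← ofReal_norm, norm_modulatedDilate k hR, ENNReal.ofReal_mul (by positivity),
    ENNReal.ofReal_inv_of_pos (by positivity), ofReal_norm, Pi.sub_apply]

variable {g h : Space d → ℂ} {S : Set (Space d)}

theorem TranslationBounded.enorm_integral_modulatedDilate_sub_le {K : ℝ≥0} {ν : Measure (Space d)}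
    (hν : TranslationBounded ρ K ν) (hρ : 0 < ρ) (hR : 0 < R)
    (hg : Integrable (modulatedDilate k g R) ν) (hh : Integrable (modulatedDilate k h R) ν)
    (hS : MeasurableSet S) (hgh : ∀ x, ‖g x - h x‖ₑ ≤ S.indicator 1 x) :
    ‖∫ x, modulatedDilate k g R x ∂ν - ∫ x, modulatedDilate k h R x ∂ν‖ₑ ≤
      K / volume (Metric.ball (0 : Space d) ρ) * volume (Metric.thickening (ρ / R) S) := by
  have hRd : ENNReal.ofReal (R ^ d) ≠ 0 := (ENNReal.ofReal_pos.2 (by positivity)).ne'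
  calc _ ≤ (ENNReal.ofReal (R ^ d))⁻¹ * ν ((R⁻¹ • ·) ⁻¹' S) := by
        refine enorm_integral_sub_le hg hh (measurable_const_smul R⁻¹ hS) fun x => ?_
        rw [enorm_modulatedDilate_sub k hR]
        refine (mul_le_mul_right (hgh _) _).trans_eq ?_
        by_cases hx : R⁻¹ • x ∈ S <;> simp [hx]
    _ ≤ _ := by
        refine (mul_le_mul_right (hν.measure_preimage_inv_smul_le hρ hR hS) _).trans_eq ?_
        rw [finrank_euclideanSpace, Fintype.card_fin, ENNReal.inv_mul_cancel_left hRd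
          ENNReal.ofReal_ne_top]

theorem enorm_weightedCount_modulatedDilate_sub_le {η : Measure (ColouredSpace d m)}
    (hη : Sparse ρ η) (hρ : 0 < ρ) (hR : 0 < R)
    (hg : ∀ i, Integrable (modulatedDilate k g R) (colour η i))
    (hh : ∀ i, Integrable (modulatedDilate k h R) (colour η i))
    (hS : MeasurableSet S) (hgh : ∀ x, ‖g x - h x‖ₑ ≤ S.indicator 1 x) :
    ‖weightedCount w (modulatedDilate k g R) η - weightedCount w (modulatedDilate k h R) η‖ₑ ≤
      (∑ i, ‖w i‖ₑ) *
        ((volume (Metric.ball (0 : Space d) ρ))⁻¹ * volume (Metric.thickening (ρ / R) S)) := by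
  rw [weightedCount, weightedCount, ← Finset.sum_sub_distrib, Finset.sum_mul]
  refine (enorm_sum_le _ _).trans (Finset.sum_le_sum fun i _ => ?_)
  rw [← mul_sub, enorm_mul, ← ofReal_norm, Complex.norm_real, ofReal_norm]
  gcongr
  simpa using (hη.colour i).enorm_integral_modulatedDilate_sub_le k hρ hR (hg i) (hh i) hS hgh

theorem enorm_average_sub_le (hr : 0 < r) (hR : 0 < R) {η : Measure (ColouredSpace d m)}
    (hη : η ∈ pointMeasures d m r) {φ : 𝓢(Space d, ℂ)} (hS : MeasurableSet S)
    (hφ : ∀ x, ‖(cube d 1).indicator 1 x - φ x‖ₑ ≤ S.indicator 1 x) :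
    ‖average w k R η - weightedCount w (modulatedDilate k φ R) η‖ₑ ≤
      (∑ i, ‖w i‖ₑ) * ((volume (Metric.ball (0 : Space d) (r / 2)))⁻¹ *
        volume (Metric.thickening (r / 2 / R) S)) := by
  have hs := Sparse.of_mem_pointMeasures hη
  obtain ⟨B, hB⟩ := exists_norm_modulatedDilate_cube_le k hR
  obtain ⟨f, hf, -⟩ := exists_schwartz_eq_modulatedDilate k φ hR
  obtain ⟨B', hB'⟩ := exists_norm_le_decayWeight f
  rw [average_eq_weightedCount w k hr hR hη]
  refine enorm_weightedCount_modulatedDilate_sub_le w k hs (half_pos hr) hR (fun i => ?_)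
    (fun i => ?_) hS hφ
  · exact (hs.colour i).integrable (half_pos hr) (b := 0) (measurable_modulatedDilate k
      (measurable_one.indicator (measurableSet_cube 1)) R).aestronglyMeasurable
      (by simpa only [sub_zero] using hB)
  · exact hf ▸ (hs.colour i).integrable (half_pos hr) (b := 0) f.continuous.aestronglyMeasurable
      (by simpa only [sub_zero] using hB')

end Cube

section Limit

theorem eLpNorm_sub_le_of_near_const_mul {α : Type*} [MeasurableSpace α] {P : Measure α}
    {p : ℝ≥0∞} (hp : 1 ≤ p) {A N L : α → ℂ} (hA : AEStronglyMeasurable A P)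
    (hN : AEStronglyMeasurable N P) (hL : AEStronglyMeasurable L P) (c : ℂ) :
    eLpNorm (fun x => A x - L x) p P ≤ eLpNorm (fun x => A x - N x) p P +
      (eLpNorm (fun x => N x - c * L x) p P + ‖c - 1‖ₑ * eLpNorm L p P) := by
  have hNL : AEStronglyMeasurable (fun x => N x - c * L x) P := hN.sub (hL.const_mul c)
  have hsplit : (fun x => A x - L x) =
      (fun x => A x - N x) + ((fun x => N x - c * L x) + (c - 1) • L) := by
    ext x
    simp only [Pi.add_apply, Pi.smul_apply, smul_eq_mul]
    ring
  rw [hsplit, ← eLpNorm_const_smul (c - 1) L p P]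
  refine (eLpNorm_add_le (hA.sub hN) (hNL.add (hL.const_smul _)) hp).trans ?_
  exact add_le_add_right (eLpNorm_add_le hNL (hL.const_smul _) hp) _

variable {d m : ℕ} {ρ r : ℝ} {μ : Measure (Measure (ColouredSpace d m))} (w : Fin m → ℝ)

theorem eventually_eLpNorm_average_sub_le (hr : 0 < r) (hμ : ∀ᵐ η ∂μ, η ∈ pointMeasures d m r)
    {S : Set (Space d)} (hS : MeasurableSet S) {φ : 𝓢(Space d, ℂ)}
    (hφ : ∀ x, ‖(cube d 1).indicator 1 x - φ x‖ₑ ≤ S.indicator 1 x) {s : ℝ} (hs : 0 < s)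
    (k : Space d) :
    ∀ᶠ R in atTop, eLpNorm (fun η => average w k R η - weightedCount w (modulatedDilate k φ R) η)
      2 μ ≤ (∑ i, ‖w i‖ₑ) * ((volume (Metric.ball (0 : Space d) (r / 2)))⁻¹ *
        volume (Metric.thickening s S)) * μ Set.univ ^ (2⁻¹ : ℝ) := by
  filter_upwards [eventually_gt_atTop 0, eventually_ge_atTop (r / 2 / s)] with R hR hRs
  refine (eLpNorm_le_of_ae_enorm_bound (p := 2) (C := (∑ i, ‖w i‖ₑ) *
    ((volume (Metric.ball (0 : Space d) (r / 2)))⁻¹ * volume (Metric.thickening s S))) ?_).trans_eq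
    (by rw [smul_eq_mul, ENNReal.toReal_ofNat])
  filter_upwards [hμ] with η hη
  refine (enorm_average_sub_le w k hr hR hη hS hφ).trans ?_
  gcongr
  exact (div_le_comm₀ hs hR).1 hRs

variable [IsFiniteMeasure μ] {ν : Measure (Space d)} {θ : Lp ℂ 2 ν →ₗᵢ[ℂ] Lp ℂ 2 μ}

theorem eLpNorm_weightedCount_modulatedDilate_sub (hρ : 0 < ρ) (hs : ∀ᵐ η ∂μ, Sparse ρ η)
    (hν : IsFourierTransform (weightedFirstMoment μ w) ν) (hθ : IsDiffractionEmbedding μ w ν θ)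
    (k : Space d) (g : 𝓢(Space d, ℂ)) {R : ℝ} (hR : 0 < R) (c : ℂ) :
    eLpNorm (fun η => weightedCount w (modulatedDilate k g R) η -
        c * θ ((memLp_indicator_singleton hν k).toLp _) η) 2 μ =
      eLpNorm (fun y => 𝓕 g (R • (y - k)) - c * Set.indicator {k} 1 y) 2 ν := by
  obtain ⟨K, hK⟩ := hν.translationBounded w hρ hs
  have := hK.hasTemperateGrowth one_pos
  obtain ⟨f, hf, hFf⟩ := exists_schwartz_eq_modulatedDilate k g hR
  set u := (memLp_indicator_singleton hν k).toLp _ with hu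
  calc _ = ‖countLp w hρ hs f - c • θ u‖ₑ := by
        rw [Lp.enorm_def]
        refine eLpNorm_congr_ae ?_
        filter_upwards [Lp.coeFn_sub (countLp w hρ hs f) (c • θ u), Lp.coeFn_smul c (θ u),
          (memLp_weightedCount_schwartz w hs hρ f 2).coeFn_toLp] with η h1 h2 h3
        rw [h1, Pi.sub_apply, h2, Pi.smul_apply, smul_eq_mul, ← hf, ← h3]
        rfl
    _ = ‖fourierLp ν f - c • u‖ₑ := by
        rw [← (isDiffractionEmbedding_iff w hρ hs θ).1 hθ f, ← map_smul, ← map_sub,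
          LinearIsometry.enorm_map]
    _ = _ := by
        rw [fourierLp_apply, hu, ← MemLp.toLp_const_smul, ← MemLp.toLp_sub, Lp.enorm_toLp]
        exact congrArg (eLpNorm · 2 ν) (funext fun y => congrArg (· - _) (hFf y))

theorem tendsto_weightedCount_modulatedDilate (hρ : 0 < ρ) (hs : ∀ᵐ η ∂μ, Sparse ρ η)
    (hν : IsFourierTransform (weightedFirstMoment μ w) ν) (hθ : IsDiffractionEmbedding μ w ν θ)
    (k : Space d) (g : 𝓢(Space d, ℂ)) :
    Tendsto (fun R : ℝ => eLpNorm (fun η => weightedCount w (modulatedDilate k g R) η -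
      𝓕 g 0 * θ ((memLp_indicator_singleton hν k).toLp _) η) 2 μ) atTop (𝓝 0) := by
  obtain ⟨K, hK⟩ := hν.translationBounded w hρ hs
  refine (hK.tendsto_eLpNorm_dilation_sub k one_pos (𝓕 g)).congr' ?_
  filter_upwards [eventually_gt_atTop 0] with R hR
  exact (eLpNorm_weightedCount_modulatedDilate_sub w hρ hs hν hθ k g hR _).symm

theorem exists_eventually_eLpNorm_average_sub_le (hr : 0 < r)
    (hμ : ∀ᵐ η ∂μ, η ∈ pointMeasures d m r) (hν : IsFourierTransform (weightedFirstMoment μ w) ν)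
    (hθ : IsDiffractionEmbedding μ w ν θ) (k : Space d) :
    ∃ M : ℝ≥0∞, M ≠ ∞ ∧ ∀ δ > 0, ∀ᶠ R in atTop, eLpNorm (fun η => average w k R η -
      θ ((memLp_indicator_singleton hν k).toLp _) η) 2 μ ≤ δ * M := by
  set L := θ ((memLp_indicator_singleton hν k).toLp _)
  have hs : ∀ᵐ η ∂μ, Sparse (r / 2) η := hμ.mono fun η hη => Sparse.of_mem_pointMeasures hη
  have hball : (volume (Metric.ball (0 : Space d) (r / 2)))⁻¹ ≠ ∞ :=
    ENNReal.inv_ne_top.2 (Metric.measure_ball_pos volume _ (half_pos hr)).ne'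
  refine ⟨(∑ i, ‖w i‖ₑ) * (volume (Metric.ball (0 : Space d) (r / 2)))⁻¹ *
    μ Set.univ ^ (2⁻¹ : ℝ) + (1 + eLpNorm L 2 μ), ?_, fun δ hδ => ?_⟩
  · have hw : ∑ i, ‖w i‖ₑ ≠ ∞ := ENNReal.sum_ne_top.2 fun i _ => enorm_ne_top
    finiteness
  obtain ⟨φ, hφ1, S, hS, hφ, s, hs0, hsδ⟩ := exists_schwartz_near_cube d hδ
  filter_upwards [eventually_gt_atTop 0,
    eventually_eLpNorm_average_sub_le w hr hμ hS hφ hs0 k,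
    ENNReal.tendsto_nhds_zero.1
      (tendsto_weightedCount_modulatedDilate w (half_pos hr) hs hν hθ k φ) δ hδ] with R hR hA hN
  obtain ⟨f, hf, -⟩ := exists_schwartz_eq_modulatedDilate k φ hR
  have hNm : AEStronglyMeasurable (weightedCount w (modulatedDilate k φ R)) μ := by
    rw [← hf]
    exact (memLp_weightedCount_schwartz w hs (half_pos hr) f 2).1
  calc _ ≤ _ := eLpNorm_sub_le_of_near_const_mul one_le_two (memLp_average w k hr hμ hR 2).1 hNm
        (Lp.aestronglyMeasurable L) (𝓕 φ 0)
    _ ≤ (∑ i, ‖w i‖ₑ) * ((volume (Metric.ball (0 : Space d) (r / 2)))⁻¹ * δ) *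
          μ Set.univ ^ (2⁻¹ : ℝ) + (δ + δ * eLpNorm L 2 μ) := by
        gcongr
        exact hA.trans (by gcongr)
    _ = _ := by ring

theorem tendsto_average (hr : 0 < r) (hμ : ∀ᵐ η ∂μ, η ∈ pointMeasures d m r)
    (hν : IsFourierTransform (weightedFirstMoment μ w) ν) (hθ : IsDiffractionEmbedding μ w ν θ)
    (k : Space d) :
    Tendsto (fun R : ℝ => eLpNorm (fun η => average w k R η -
      θ ((memLp_indicator_singleton hν k).toLp _) η) 2 μ) atTop (𝓝 0) := by
  obtain ⟨M, hM, hbound⟩ := exists_eventually_eLpNorm_average_sub_le w hr hμ hν hθ k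
  refine ENNReal.tendsto_nhds_zero.2 fun e he => ?_
  obtain ⟨δ, hδ, hδe⟩ := ENNReal.exists_nnreal_pos_mul_lt hM he.ne'
  exact (hbound δ (by exact_mod_cast hδ)).mono fun R hR => hR.trans hδe.le

end Limit

section Reflection

variable {E : Type*} [NormedAddCommGroup E] [InnerProductSpace ℝ E] [FiniteDimensional ℝ E]
  [MeasurableSpace E] [BorelSpace E]

theorem fourier_comp_neg (f : E → ℂ) (y : E) :
    𝓕 (fun x => f (-x)) y = conj (𝓕 (fun x => conj (f x)) y) := by
  rw [Real.fourier_eq, Real.fourier_eq, ← integral_conj, ← integral_neg_eq_self]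
  refine integral_congr_ae (Eventually.of_forall fun x => ?_)
  simp only [Circle.smul_def, smul_eq_mul, map_mul, Complex.conj_conj, neg_neg, inner_neg_left]
  rw [← Circle.coe_inv_eq_conj, ← AddChar.map_neg_eq_inv, neg_neg]

variable {d : ℕ} {ω : (Space d → ℂ) → ℂ} {ν : Measure (Space d)}

theorem IsFourierTransform.integral_comp_neg (hν : IsFourierTransform ω ν)
    (hω : ∀ f, ω (fun x => conj (f x)) = conj (ω f)) (f : 𝓢(Space d, ℂ)) :
    ∫ x, f (-x) ∂ν = ∫ x, f x ∂ν := by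
  let reflect : 𝓢(Space d, ℂ) :=
    SchwartzMap.compCLMOfContinuousLinearEquiv ℝ (ContinuousLinearEquiv.neg ℝ) f
  let conjugate : 𝓢(Space d, ℂ) :=
    SchwartzMap.postcompCLM (𝕜 := ℝ) Complex.conjCLE.toContinuousLinearMap f
  have hfourier : ∀ y, (𝓕 reflect : 𝓢(Space d, ℂ)) y =
      conj ((𝓕 conjugate : 𝓢(Space d, ℂ)) y) := fun y => by
    rw [SchwartzMap.fourier_coe, SchwartzMap.fourier_coe]
    exact fourier_comp_neg f y
  calc ∫ x, reflect x ∂ν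
      = ω fun y => conj ((𝓕 conjugate : 𝓢(Space d, ℂ)) y) := by
        rw [hν.integral_eq reflect, funext hfourier]
    _ = conj (∫ x, conj (f x) ∂ν) := by rw [hω, ← hν.integral_eq conjugate]; rfl
    _ = ∫ x, f x ∂ν := by rw [integral_conj, Complex.conj_conj]

theorem IsFourierTransform.map_neg (hν : IsFourierTransform ω ν)
    (hω : ∀ f, ω (fun x => conj (f x)) = conj (ω f)) : IsFourierTransform ω (ν.map Neg.neg) := by
  have := hν.isLocallyFinite
  have hfin : IsFiniteMeasureOnCompacts (ν.map Neg.neg) :=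
    Measure.IsFiniteMeasureOnCompacts.map ν (Homeomorph.neg (Space d))
  have hemb : MeasurableEmbedding (Neg.neg : Space d → Space d) :=
    (Homeomorph.neg (Space d)).measurableEmbedding
  refine ⟨isLocallyFiniteMeasure_of_isFiniteMeasureOnCompacts, fun f => ?_, fun f => ?_⟩
  · rw [hemb.integrable_map_iff]
    exact hν.integrable
      (SchwartzMap.compCLMOfContinuousLinearEquiv ℝ (ContinuousLinearEquiv.neg ℝ) f)
  · rw [hemb.integral_map, hν.integral_comp_neg hω, hν.integral_eq]

theorem IsFourierTransform.measure_singleton_neg (hν : IsFourierTransform ω ν)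
    (hω : ∀ f, ω (fun x => conj (f x)) = conj (ω f)) (k : Space d) : ν {-k} = ν {k} := by
  have h : ν.map Neg.neg {k} = ν {k} := by rw [hν.unique (hν.map_neg hω)]
  rwa [Measure.map_apply measurable_neg (measurableSet_singleton k), Set.neg_preimage,
    Set.neg_singleton] at h

end Reflection

section Eigenvalue

variable {d m : ℕ} {ν : Measure (Space d)} {k : Space d}

theorem eq_neg_of_character_eq {x : Space d} (h : ∀ t, character (-t) x = character k t) :
    x = -k := by
  by_contra hx
  have hne : ‖x + k‖ ≠ 0 := norm_ne_zero_iff.2 fun h0 => hx (eq_neg_of_add_eq_zero_left h0)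
  -- For this `t` the two characters differ by the factor `exp(πi) = -1`.
  set t := (2 * ‖x + k‖ ^ 2)⁻¹ • (x + k) with ht
  have hin : inner ℝ k t = 1 / 2 + inner ℝ (-t) x := by
    have hhalf : inner ℝ t (x + k) = (1 / 2 : ℝ) := by
      rw [ht, real_inner_smul_left, real_inner_self_eq_norm_sq]
      field_simp
    rw [inner_add_right] at hhalf
    rw [inner_neg_left, real_inner_comm]
    linarith
  have hneg : character k t = -character (-t) x := by
    rw [character, character, hin, ← neg_one_mul, ← Complex.exp_pi_mul_I, ← Complex.exp_add]
    congr 1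
    push_cast
    ring
  have hzero := h t
  rw [hneg, self_eq_neg, ← norm_eq_zero, norm_character] at hzero
  exact one_ne_zero hzero

theorem coeFn_U (t : Space d) (f : Lp ℂ 2 ν) : U ν t f =ᵐ[ν] fun x => character (-t) x * f x :=
  (memLp_character_mul (-t) (Lp.memLp f)).coeFn_toLp

theorem ae_eq_neg_of_eigenfunction {f : Lp ℂ 2 ν} (h : ∀ t, U ν t f = character k t • f) :
    ∀ᵐ x ∂ν, f x ≠ 0 → x = -k := by
  have hseq : ∀ᵐ x ∂ν, ∀ n : ℕ, character (-TopologicalSpace.denseSeq (Space d) n) x * f x =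
      character k (TopologicalSpace.denseSeq (Space d) n) * f x := by
    refine ae_all_iff.2 fun n => ?_
    have hU := coeFn_U (TopologicalSpace.denseSeq (Space d) n) f
    rw [h] at hU
    exact hU.symm.trans (Lp.coeFn_smul _ f)
  filter_upwards [hseq] with x hx hfx
  have hcont : Continuous fun t => character (-t) x := by
    unfold character
    fun_prop
  exact eq_neg_of_character_eq (congrFun ((TopologicalSpace.denseRange_denseSeq _).equalizer hcont
    (continuous_character k) (funext fun n => mul_right_cancel₀ hfx (hx n))))

variable {ω : (Space d → ℂ) → ℂ}

theorem U_indicator_singleton (hν : IsFourierTransform ω ν) (k t : Space d) :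
    U ν t ((memLp_indicator_singleton hν (-k)).toLp _) =
      character k t • (memLp_indicator_singleton hν (-k)).toLp _ := by
  set u := (memLp_indicator_singleton hν (-k)).toLp _
  refine Lp.ext ?_
  filter_upwards [coeFn_U t u, Lp.coeFn_smul (character k t) u,
    (memLp_indicator_singleton hν (-k)).coeFn_toLp] with x hU hsmul hu
  rw [hU, hsmul, Pi.smul_apply, hu, smul_eq_mul]
  by_cases hx : x = -k
  · rw [hx, character, character, inner_neg_neg, real_inner_comm]
  · rw [Set.indicator_of_notMem (show x ∉ ({-k} : Set (Space d)) from hx), mul_zero, mul_zero]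

theorem toLp_indicator_singleton_eq_zero_iff (hν : IsFourierTransform ω ν) (k : Space d) :
    (memLp_indicator_singleton hν k).toLp _ = 0 ↔ ν {k} = 0 := by
  rw [Lp.eq_zero_iff_ae_eq_zero, (memLp_indicator_singleton hν k).coeFn_toLp.congr_left,
    Set.indicator_ae_eq_zero, Function.support_const one_ne_zero, Set.inter_univ]

theorem isEigenvalue_iff (hν : IsFourierTransform ω ν) (k : Space d) :
    IsEigenvalue ν k ↔ ν {-k} ≠ 0 := by
  refine ⟨fun ⟨f, hf, h⟩ h0 => hf (Lp.eq_zero_iff_ae_eq_zero.2 ?_), fun h =>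
    ⟨_, mt (toLp_indicator_singleton_eq_zero_iff hν (-k)).1 h, U_indicator_singleton hν k⟩⟩
  filter_upwards [ae_eq_neg_of_eigenfunction h, measure_eq_zero_iff_ae_notMem.1 h0] with x hx hxk
  by_contra hfx
  exact hxk (hx hfx)

theorem tendsto_average_zero_iff {r : ℝ} {μ : Measure (Measure (ColouredSpace d m))}
    [IsFiniteMeasure μ] (w : Fin m → ℝ) (hr : 0 < r) (hμ : ∀ᵐ η ∂μ, η ∈ pointMeasures d m r)
    (hν : IsFourierTransform (weightedFirstMoment μ w) ν) {θ : Lp ℂ 2 ν →ₗᵢ[ℂ] Lp ℂ 2 μ}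
    (hθ : IsDiffractionEmbedding μ w ν θ) (k : Space d) :
    Tendsto (fun R : ℝ => eLpNorm (average w k R) 2 μ) atTop (𝓝 0) ↔ ν {k} = 0 := by
  have hlim := tendsto_average w hr hμ hν hθ k
  rw [← toLp_indicator_singleton_eq_zero_iff hν k, ← map_eq_zero_iff θ θ.injective]
  set L := θ ((memLp_indicator_singleton hν k).toLp _)
  refine ⟨fun h => ?_, fun h => hlim.congr fun R => eLpNorm_congr_ae ?_⟩
  · have hsum := h.add hlim
    rw [add_zero] at hsum
    rw [← enorm_eq_zero, ← nonpos_iff_eq_zero, Lp.enorm_def]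
    refine ge_of_tendsto hsum ?_
    filter_upwards [eventually_gt_atTop 0] with R hR
    have hA : AEStronglyMeasurable (average w k R) μ := (memLp_average w k hr hμ hR 2).1
    have hL : ⇑L = average w k R - fun η => average w k R η - L η := by
      ext η
      simp
    calc eLpNorm L 2 μ = eLpNorm (average w k R - fun η => average w k R η - L η) 2 μ :=
          congrArg (eLpNorm · 2 μ) hL
      _ ≤ _ := eLpNorm_sub_le hA (hA.sub (Lp.aestronglyMeasurable L)) one_le_two
  · filter_upwards [Lp.eq_zero_iff_ae_eq_zero.1 h] with η hη
    rw [hη, Pi.zero_apply, sub_zero]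

end Eigenvalue

end ColouredPointProcess

open ColouredPointProcess in
theorem theorem9p1_general {d m : ℕ} {μ : Measure (Measure (ColouredSpace d m))}
    [IsFiniteMeasure μ] {r : ℝ} (hr : 0 < r) (hμ : ∀ᵐ η ∂μ, η ∈ pointMeasures d m r)
    (hst : ∀ t, μ.map (translate t) = μ) (w : Fin m → ℝ) :
    ∃ (ν : Measure (Space d)) (hν : IsFourierTransform (weightedFirstMoment μ w) ν),
      (∀ ν', IsFourierTransform (weightedFirstMoment μ w) ν' → ν' = ν) ∧
    ∃ θ : Lp ℂ 2 ν →ₗᵢ[ℂ] Lp ℂ 2 μ, IsDiffractionEmbedding μ w ν θ ∧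
      (∀ θ', IsDiffractionEmbedding μ w ν θ' → θ' = θ) ∧
    ∀ k : Space d,
      (∀ R : ℝ, 0 < R → MemLp (average w k R) 2 μ) ∧
      List.TFAE [¬ Tendsto (fun R : ℝ => eLpNorm (average w k R) 2 μ) atTop (𝓝 0),
        ν {k} ≠ 0, IsEigenvalue ν k] ∧
      Tendsto (fun R : ℝ => eLpNorm (fun η =>
        average w k R η - θ ((memLp_indicator_singleton hν k).toLp _) η) 2 μ) atTop (𝓝 0) := by
  have hs : ∀ᵐ η ∂μ, Sparse (r / 2) η := hμ.mono fun η => Sparse.of_mem_pointMeasures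
  obtain ⟨ν, hν⟩ := exists_isFourierTransform w (half_pos hr) hs hst
  obtain ⟨K, hK⟩ := hν.translationBounded w (half_pos hr) hs
  have := hK.hasTemperateGrowth one_pos
  obtain ⟨θ, hθ, hθ_unique⟩ := hν.existsUnique_embedding w (half_pos hr) hs hst
  refine ⟨ν, hν, fun ν' => hν.unique, θ, hθ, hθ_unique, fun k =>
    ⟨fun R hR => memLp_average w k hr hμ hR 2, ?_, tendsto_average w hr hμ hν hθ k⟩⟩
  tfae_have 1 ↔ 2 := not_congr (tendsto_average_zero_iff w hr hμ hν hθ k)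
  tfae_have 3 ↔ 2 := by
    rw [isEigenvalue_iff hν, hν.measure_singleton_neg (weightedFirstMoment_conj w)]
  tfae_finish

theorem theorem9p1 {d m : ℕ}
    (μ : Measure (Measure (ColouredPointProcess.ColouredSpace d m)))
    (hμ : ColouredPointProcess.IsUniformlyDiscreteStationaryErgodic μ)
    (w : Fin m → ℝ) :
    -- the Fourier transform `ν` of the weighted first moment exists, is a positive measure, and
    -- is unique
    ∃ (ν : Measure (ColouredPointProcess.Space d))
      (hν : ColouredPointProcess.IsFourierTransform
        (ColouredPointProcess.weightedFirstMoment μ w) ν),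
      (∀ ν' : Measure (ColouredPointProcess.Space d),
        ColouredPointProcess.IsFourierTransform
          (ColouredPointProcess.weightedFirstMoment μ w) ν' → ν' = ν) ∧
    -- the isometric embedding `θ` exists and is unique
    ∃ θ : Lp ℂ 2 ν →ₗᵢ[ℂ] Lp ℂ 2 μ,
      ColouredPointProcess.IsDiffractionEmbedding μ w ν θ ∧
      (∀ θ' : Lp ℂ 2 ν →ₗᵢ[ℂ] Lp ℂ 2 μ,
        ColouredPointProcess.IsDiffractionEmbedding μ w ν θ' → θ' = θ) ∧
    ∀ k : ColouredPointProcess.Space d,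
      -- the averages are elements of `L²(μ)`
      (∀ R : ℝ, 0 < R → MemLp (ColouredPointProcess.average w k R) 2 μ) ∧
      -- the three equivalent conditions
      List.TFAE
        [¬ Tendsto (fun R : ℝ => eLpNorm (ColouredPointProcess.average w k R) 2 μ) atTop (𝓝 0),
          ν {k} ≠ 0,
          ColouredPointProcess.IsEigenvalue ν k] ∧
      -- the limit of the averages
      (ColouredPointProcess.IsEigenvalue ν k →
        Tendsto (fun R : ℝ => eLpNorm
            (fun η => ColouredPointProcess.average w k R η -
              θ ((ColouredPointProcess.memLp_indicator_singleton hν k).toLp _) η) 2 μ)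
          atTop (𝓝 0)) := by
  obtain ⟨r, hr, hμr⟩ := hμ.uniformlyDiscrete
  have := hμ.isProbabilityMeasure
  obtain ⟨ν, hν, hν_unique, θ, hθ, hθ_unique, h⟩ := theorem9p1_general hr hμr hμ.stationary w
  exact ⟨ν, hν, hν_unique, θ, hθ, hθ_unique,
    fun k => ⟨(h k).1, (h k).2.1, fun _ => (h k).2.2⟩⟩
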